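/- All graphs are finite and loopless; parallel edges are allowed. A cycle is a connected $2$-regular graph (two parallel edges form a cycle). A Kotzig graph is a cubic graph which has a proper $3$-edge-coloring such that every cycle whose edges have at most two colors is hamiltonian. A subdivision of a graph $H$ is a graph obtained from $H$ by replacing at least one edge $vw$ by a $vw$-path of length at least $2$. Let $G$ be a $2$-connected cubic graph and let $F$ be a Kotzig-frame of $G$, that is, a spanning subgraph of $G$ such that every component of $F$ has an even number of vertices and is either a cycle or a subdivision of a Kotzig graph. Let $G_F$ be the multigraph obtained from $G$ by contracting every component of $F$ to a distinct vertex and deleting all loops. Let $\tilde C$ be the set of vertices of $G_F$ which correspond to components of $F$ that are cycles, and let $\tilde K$ be the set of all other vertices of $G_F$. (A graph without vertices counts as connected below.) Suppose that at least one of the following holds: (i) $\tilde K$ is an independent set in $G_F$ and $G_F-\tilde K$ is connected; (ii) every vertex of $\tilde K$ is adjacent in $G_F$ to a vertex of $\tilde C$, and $G_F-\tilde K$ is connected; (iii) there is a subset $C^*\subseteq\tilde C$ such that the induced subgraph $G_F[C^*]$ is connected and every vertex of $\tilde K$ is adjacent in $G_F$ to a vertex of $C^*$. Then $G$ has a $6$-cycle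 double cover, that is, a set $S$ of cycles of $G$ such that every edge of $G$ lies in precisely two cycles of $S$, and such that $S$ can be partitioned into $6$ (possibly empty) classes each of which consists of pairwise edge-disjoint cycles. -/

import Mathlib

open scoped Graph

namespace Graph

variable {α β γ : Type*}

/-! ### Degrees, connectedness, cycles and paths in multigraphs -/

/-- The degree of a vertex: the number of incident edges, loops counted twice. -/
noncomputable def degree (G : Graph α β) (v : α) : ℕ :=
  (G.incidenceSet v).ncard + (G.loopSet v).ncard

/-- A finite loopless multigraph in which every vertex has degree `3`. -/
structure IsCubic (G : Graph α β) : Prop where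
  finite_vertexSet : V(G).Finite
  finite_edgeSet : E(G).Finite
  loopless : G.Loopless
  degree_eq : ∀ v ∈ V(G), G.degree v = 3

/-- Any two vertices are joined by a walk. The graph without vertices is allowed. -/
def Preconnected (G : Graph α β) : Prop :=
  ∀ x ∈ V(G), ∀ y ∈ V(G), Relation.ReflTransGen G.Adj x y

/-- A nonempty graph in which any two vertices are joined by a walk. -/
def Connected (G : Graph α β) : Prop :=
  V(G).Nonempty ∧ G.Preconnected

/-- A connected graph with at least two vertices and without cut vertices. -/
def IsTwoConnected (G : Graph α β) : Prop :=
  V(G).Nontrivial ∧ G.Connected ∧ ∀ v ∈ V(G), (G.deleteVerts {v}).Connected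

/-- `L` is a connected component of `F`: a nonempty connected subgraph which contains all edges
of `F` that are incident with one of its vertices. -/
def IsComponent (L F : Graph α β) : Prop :=
  L ≤c F ∧ L.Connected

/-- A cycle is a connected `2`-regular graph. (This is only used for finite loopless graphs; two
parallel edges form a cycle.) -/
def IsCycle (C : Graph α β) : Prop :=
  C.Connected ∧ ∀ v ∈ V(C), C.degree v = 2

/-- `P` is a path with the two distinct end vertices `x` and `y`: a connected graph in which `x`
and `y` have degree `1` and all other vertices have degree `2`. -/
def IsPathBetween (P : Graph α β) (x y : α) : Prop :=
  P.Connected ∧ x ≠ y ∧ x ∈ V(P) ∧ y ∈ V(P) ∧ P.degree x = 1 ∧ P.degree y = 1 ∧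
    ∀ v ∈ V(P), v ≠ x → v ≠ y → P.degree v = 2

/-! ### Kotzig graphs and subdivisions -/

/-- A Kotzig-coloring: a proper `3`-edge-coloring `c` of `K` such that every cycle of `K` whose
edges have at most two colors is a hamiltonian cycle of `K`. -/
structure IsKotzigColoring (K : Graph α β) (c : β → Fin 3) : Prop where
  proper : ∀ e f v, e ≠ f → K.Inc e v → K.Inc f v → c e ≠ c f
  hamiltonian : ∀ C ≤ K, C.IsCycle → (∃ a b, ∀ e ∈ E(C), c e = a ∨ c e = b) → V(C) = V(K)

/-- A Kotzig graph: a cubic graph which has a Kotzig-coloring. -/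
def IsKotzig (K : Graph α β) : Prop :=
  K.IsCubic ∧ ∃ c : β → Fin 3, K.IsKotzigColoring c

/-- `S` arises from the (loopless) graph `K` by replacing every edge `e = xy` of `K` by an
`xy`-path `P e`, at least one of these paths having length at least `2`. The vertices of `K` stay
vertices of `S`; the inner vertices of the paths are new and the paths are internally disjoint. -/
def IsSubdivision (S : Graph α β) (K : Graph α γ) : Prop :=
  ∃ P : γ → Graph α β,
    (∀ e x y, K.IsLink e x y →
      P e ≤ S ∧ (P e).IsPathBetween x y ∧ V(P e) ∩ V(K) = {x, y}) ∧
    (∀ e ∈ E(K), ∀ f ∈ E(K), e ≠ f →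
      Disjoint E(P e) E(P f) ∧ V(P e) ∩ V(P f) ⊆ V(K)) ∧
    V(S) = V(K) ∪ ⋃ e ∈ E(K), V(P e) ∧
    E(S) = ⋃ e ∈ E(K), E(P e) ∧
    ∃ e ∈ E(K), 2 ≤ E(P e).ncard

/-- `S` is a subdivision of some Kotzig graph. It is no restriction to take the edges of that
graph from the edge type of `S`: an edge can be named after an edge of the path replacing it. -/
def IsKotzigSubdivision (S : Graph α β) : Prop :=
  ∃ K : Graph α β, K.IsKotzig ∧ S.IsSubdivision K

/-! ### Kotzig-frames -/

/-- `F` is a Kotzig-frame of `G`: a spanning subgraph each of whose components has an even number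
of vertices and is a cycle or a subdivision of a Kotzig graph. -/
structure IsKotzigFrame (F G : Graph α β) : Prop where
  spanning : F ≤s G
  even : ∀ L : Graph α β, L.IsComponent F → Even V(L).ncard
  cycle_or_subdivision : ∀ L : Graph α β, L.IsComponent F → L.IsCycle ∨ L.IsKotzigSubdivision

/-- Components of `F` with a common vertex are equal. -/
lemma IsComponent.eq_of_mem {L M F : Graph α β} (hL : L.IsComponent F) (hM : M.IsComponent F)
    {x : α} (hxL : x ∈ V(L)) (hxM : x ∈ V(M)) : L = M := by
  have key : ∀ {A B : Graph α β}, A.IsComponent F → B.IsComponent F → x ∈ V(A) → x ∈ V(B) →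
      V(A) ⊆ V(B) := by
    intro A B hA hB hxA hxB y hy
    have h := hA.2.2 x hxA y hy
    clear hy
    induction h with
    | refl => exact hxB
    | tail _ hbc ih => exact (hB.1.mem_iff_of_adj (hbc.mono hA.1.le)).1 ih
  have hV : V(L) = V(M) := (key hL hM hxL hxM).antisymm (key hM hL hxM hxL)
  refine Graph.ext hV fun e a b => ⟨fun h => ?_, fun h => ?_⟩
  · exact hM.1.isLink_of_mem_mem (h.mono hL.1.le) (hV ▸ h.left_mem) (hV ▸ h.right_mem)
  · exact hL.1.isLink_of_mem_mem (h.mono hM.1.le) (hV ▸ h.left_mem) (hV ▸ h.right_mem)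

/-- The multigraph `G_F`, obtained from `G` by contracting every component of `F` to a distinct
vertex and deleting all loops. Its vertices are the components of `F`, its edges are the edges of
`G` which join different components of `F`. -/
def contractFrame (G F : Graph α β) : Graph (Graph α β) β where
  vertexSet := {L | L.IsComponent F}
  IsLink e X Y := X.IsComponent F ∧ Y.IsComponent F ∧ X ≠ Y ∧
    ∃ x ∈ V(X), ∃ y ∈ V(Y), G.IsLink e x y
  isLink_symm := by
    intro e _
    refine ⟨?_⟩
    rintro X Y ⟨hX, hY, hne, x, hx, y, hy, h⟩
    exact ⟨hY, hX, hne.symm, y, hy, x, hx, h.symm⟩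
  eq_or_eq_of_isLink_of_isLink := by
    rintro e X Y Z W ⟨hX, hY, _, x, hx, y, hy, h⟩ ⟨hZ, hW, _, z, hz, w, hw, h'⟩
    rcases h.left_eq_or_eq h' with rfl | rfl
    · exact Or.inl (hX.eq_of_mem hZ hx hz)
    · exact Or.inr (hX.eq_of_mem hW hx hw)
  left_mem_of_isLink := by
    rintro e X Y ⟨hX, _⟩
    exact hX

/-- The C-vertices of `G_F`: the components of `F` which are cycles. -/
def cVertices (F : Graph α β) : Set (Graph α β) :=
  {L | L.IsComponent F ∧ L.IsCycle}

/-- The K-vertices of `G_F`: the components of `F` which are not cycles. -/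
def kVertices (F : Graph α β) : Set (Graph α β) :=
  {L | L.IsComponent F ∧ ¬ L.IsCycle}

/-! ### Cycle double covers -/

/-- `S` is a cycle double cover of `G`: a set of cycles of `G` such that every edge of `G` lies in
precisely two of them. -/
structure IsCycleDoubleCover (G : Graph α β) (S : Set (Graph α β)) : Prop where
  isCycle : ∀ C ∈ S, C ≤ G ∧ C.IsCycle
  ncard_eq_two : ∀ e ∈ E(G), {C ∈ S | e ∈ E(C)}.ncard = 2

/-- `G` has a `k`-cycle double cover: a cycle double cover that can be split into `k` (possibly
empty) classes, each consisting of pairwise edge-disjoint cycles. -/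
def HasCycleDoubleCover (G : Graph α β) (k : ℕ) : Prop :=
  ∃ S : Set (Graph α β), G.IsCycleDoubleCover S ∧
    ∃ c : Graph α β → Fin k, ∀ C ∈ S, ∀ D ∈ S, C ≠ D → c C = c D → Disjoint E(C) E(D)

end Graph

namespace Graph

/-! ### Joins over `ZMod 2` -/

section Joins

variable {α β Q : Type*}

/-! Split the edges of `G` into the frame edges and the set `M` of the remaining edges. Color the
edges of each component of `F` with three colors: a cycle gets one color, and in a subdivision each
path inherits the Kotzig color of the edge it replaces. For each color `i`, the edges of a component
whose color is not `i` form an even subgraph with at most one nontrivial component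
(`IsFrameColoring`). An end of an edge of `M` has degree two in `F`, so it sees a single color
there.

Suppose that the edges of `M` are labelled with the three colors so that a label differs from the
colors seen at both ends and every label occurs evenly at each component (`exists_labelling`). Let
`N` be the edges of `M` with label `i`, and `H` the frame edges whose color is not `i`. All ends of
`N` lie on `H`, evenly many in each component, so some `J ⊆ H` has the same boundary as `N`. Then `N
∪ J` and `N ∪ (H \ J)` are even. Over the three labels this gives six even sets; an edge of `M` is
covered twice by its own label, a frame edge once for each of the two other colors
(`hasCycleDoubleCover_of_join`). In a cubic graph the nontrivial components of even sets are cycles,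
and no cycle arises from two of the six sets.

The labelling uses the freedom to permute colors in each component separately. It exists when a set
`R` of components, containing all those that are not cycles, is connected by edges of `M` whose ends
see one special color per component. A component that is not a cycle has a special color as soon as
the connecting edges meet it in one vertex only; each of the three hypotheses provides such
connecting edges. -/

open scoped Classical in
/-- The boundary of an edge with ends `x` and `y`, as a vector over `ZMod 2`. -/
noncomputable def bdry (x y : Q) : Q → ZMod 2 :=
  fun q => (if q = x then 1 else 0) + (if q = y then 1 else 0)

lemma bdry_comm (x y : Q) : bdry x y = bdry y x := by
  funext q; simp only [bdry]; ring

lemma zmod_two_add_self (a : ZMod 2) : a + a = 0 := CharTwo.add_self_eq_zero a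

lemma bdry_self (x : Q) : bdry x x = 0 := by
  funext q; simp only [bdry, zmod_two_add_self, Pi.zero_apply]

lemma bdry_add_bdry (x y z : Q) : bdry x y + bdry y z = bdry x z := by
  classical
  funext q
  simp only [bdry, Pi.add_apply]
  have := zmod_two_add_self (if q = y then 1 else 0)
  linear_combination this

lemma bdry_of_ne {x y q : Q} (hx : q ≠ x) (hy : q ≠ y) : bdry x y q = 0 := by
  simp [bdry, hx, hy]

lemma sum_bdry_eq_zero {W : Finset Q} {x y : Q} (hx : x ∈ W) (hy : y ∈ W) :
    ∑ q ∈ W, bdry x y q = 0 := by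
  classical
  simp only [bdry, Finset.sum_add_distrib, Finset.sum_ite_eq', hx, hy, if_true]
  rfl

open scoped Classical in
lemma sum_fiber_bdry {W : Finset α} (g : α → Q) {x y : α} (hx : x ∈ W) (hy : y ∈ W) (q : Q) :
    ∑ v ∈ W with g v = q, bdry x y v = bdry (g x) (g y) q := by
  simp only [bdry, Finset.sum_add_distrib, Finset.sum_ite_eq', Finset.mem_filter, hx, hy, true_and,
    @eq_comm _ q]

/-- Boundaries telescope along a walk, and orientation is irrelevant in characteristic two. -/
lemma bdry_mem_of_eqvGen {S : Submodule (ZMod 2) (Q → ZMod 2)} {r : Q → Q → Prop}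
    (hr : ∀ x y, r x y → bdry x y ∈ S) {x y : Q} (h : Relation.EqvGen r x y) : bdry x y ∈ S := by
  induction h with
  | rel x y h => exact hr x y h
  | refl x => rw [bdry_self]; exact S.zero_mem
  | symm x y _ ih => rwa [bdry_comm]
  | trans x y z _ _ ih1 ih2 => rw [← bdry_add_bdry x y z]; exact S.add_mem ih1 ih2

/-- A vector whose sum over each fiber of `g` vanishes lies in every submodule which contains the
differences of any two unit vectors in the support belonging to the same fiber. -/
lemma mem_of_sum_fiber_eq_zero [DecidableEq Q] {S : Submodule (ZMod 2) (α → ZMod 2)} (g : α → Q)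
    (W : Finset α) (t : α → ZMod 2) (hW : ∀ x, t x ≠ 0 → x ∈ W)
    (hS : ∀ x y, t x ≠ 0 → t y ≠ 0 → g x = g y → bdry x y ∈ S)
    (hsum : ∀ q, ∑ x ∈ W with g x = q, t x = 0) : t ∈ S := by
  classical
  have h01 : ∀ a : ZMod 2, a ≠ 0 → a = 1 := by decide
  set T := W.filter (fun x => t x ≠ 0) with hT
  -- `rep x` depends only on the fiber of `x`. In the sum of all `bdry x (rep x)` over the support,
  -- a representative is counted once per support element of its fiber, which is an even number;
  -- only `t` survives.
  let rep : α → α := fun x => @Classical.epsilon α ⟨x⟩ (fun y => t y ≠ 0 ∧ g y = g x)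
  have hrep : ∀ x, t x ≠ 0 → t (rep x) ≠ 0 ∧ g (rep x) = g x := fun x hx =>
    @Classical.epsilon_spec α (fun y => t y ≠ 0 ∧ g y = g x) ⟨x, hx, rfl⟩
  have hcong : ∀ x y, g x = g y → rep x = rep y := fun x y h => by
    simp only [rep, h]
  have key : t = ∑ x ∈ T, bdry x (rep x) := by
    funext z
    simp only [Finset.sum_apply, bdry, Finset.sum_add_distrib, Finset.sum_ite_eq]
    have h1 : (if z ∈ T then (1 : ZMod 2) else 0) = t z := by
      by_cases hz : t z = 0
      · simp [hT, hz]
      · simp [hT, hW z hz, h01 _ hz]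
    have h2 : ∑ x ∈ T, (if z = rep x then (1 : ZMod 2) else 0) = 0 := by
      by_cases hz : ∃ x0, t x0 ≠ 0 ∧ z = rep x0
      · obtain ⟨x0, hx0, rfl⟩ := hz
        refine Eq.trans ?_ (hsum (g x0))
        rw [hT, Finset.sum_filter, Finset.sum_filter]
        refine Finset.sum_congr rfl fun x _ => ?_
        by_cases hx : t x = 0
        · simp [hx]
        · by_cases hg : g x = g x0
          · simp [hg, hcong x x0 hg, h01 _ hx]
          · have : rep x0 ≠ rep x := fun h => hg <| by
              rw [← (hrep x hx).2, ← (hrep x0 hx0).2, h]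
            simp [hg, this]
      · refine Finset.sum_eq_zero fun x hx => if_neg fun h => hz ⟨x, ?_, h⟩
        exact (Finset.mem_filter.1 hx).2
    rw [h1, h2, add_zero]
  rw [key]
  refine S.sum_mem fun x hx => ?_
  have hx' := (Finset.mem_filter.1 hx).2
  exact hS x (rep x) hx' (hrep x hx').1 (hrep x hx').2.symm

variable (u w : β → Q)

/-- The boundary of a finite set of edges. -/
noncomputable def bd (A : Finset β) (q : Q) : ZMod 2 := ∑ e ∈ A, bdry (u e) (w e) q

/-- The vectors which are boundaries of sets of edges in `A`. -/
noncomputable def bdSpan (A : Finset β) : Submodule (ZMod 2) (Q → ZMod 2) :=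
  Submodule.span (ZMod 2) ((fun e => bdry (u e) (w e)) '' A)

variable {u w}

lemma bdry_mem_bdSpan {A : Finset β} {e : β} (he : e ∈ A) : bdry (u e) (w e) ∈ bdSpan u w A :=
  Submodule.subset_span ⟨e, he, rfl⟩

/-- Coefficients in `ZMod 2` are indicator functions, so a linear combination of edge boundaries is
the boundary of a subset. Finding joins thus becomes a question of membership in a span. -/
lemma exists_bd_eq_of_mem_bdSpan {A : Finset β} {t : Q → ZMod 2} (ht : t ∈ bdSpan u w A) :
    ∃ J ⊆ A, ∀ q, bd u w J q = t q := by
  classical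
  obtain ⟨c, hc⟩ := (Submodule.mem_span_image_finset_iff_exists_fun' _).1 ht
  refine ⟨A.filter (fun e => c e ≠ 0), Finset.filter_subset _ _, fun q => ?_⟩
  rw [← hc, bd, Finset.sum_filter, Finset.sum_apply]
  refine Finset.sum_congr rfl fun e _ => ?_
  have h01 : ∀ a : ZMod 2, a ≠ 0 → a = 1 := by decide
  by_cases h : c e = 0
  · simp [h]
  · simp [h01 _ h]

lemma bd_union [DecidableEq β] {A B : Finset β} (h : Disjoint A B) (q : Q) :
    bd u w (A ∪ B) q = bd u w A q + bd u w B q :=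
  Finset.sum_union h

lemma bd_sdiff [DecidableEq β] {A B : Finset β} (h : B ⊆ A) (q : Q) :
    bd u w (A \ B) q = bd u w A q + bd u w B q := by
  have := Finset.sum_sdiff (f := fun e => bdry (u e) (w e) q) h
  have h2 := zmod_two_add_self (bd u w B q)
  simp only [bd] at *
  linear_combination this - h2

lemma sum_bd_eq_zero [Fintype Q] (A : Finset β) : ∑ q, bd u w A q = 0 := by
  simp only [bd]
  rw [Finset.sum_comm]
  exact Finset.sum_eq_zero fun e _ => sum_bdry_eq_zero (Finset.mem_univ _) (Finset.mem_univ _)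

/-- Every signed graph can be switched so that the ends of each edge are joined by positive
edges. -/
lemma exists_switching (M : Finset β) (u w : β → Q) (σ : β → ZMod 2) :
    ∃ s : Q → ZMod 2, ∀ e ∈ M, Relation.EqvGen
      (fun x y => ∃ f ∈ M, u f = x ∧ w f = y ∧ σ f + s x + s y = 0) (u e) (w e) := by
  classical
  induction M using Finset.induction_on with
  | empty => exact ⟨0, by simp⟩
  | insert e M _ ih =>
    obtain ⟨s, hs⟩ := ih
    set r : Q → Q → Prop := fun x y => ∃ f ∈ M, u f = x ∧ w f = y ∧ σ f + s x + s y = 0 with hr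
    by_cases hc : Relation.EqvGen r (u e) (w e)
    · refine ⟨s, fun f hf => ?_⟩
      have : Relation.EqvGen r (u f) (w f) := by
        rcases Finset.mem_insert.1 hf with rfl | hf
        · exact hc
        · exact hs f hf
      exact this.mono fun x y ⟨f, hf, h⟩ => ⟨f, Finset.mem_insert_of_mem hf, h⟩
    -- The ends of `e` lie in different positive classes. Switching the whole class of `u e` by `a`
    -- makes `e` positive; earlier edges have both ends in one class, so their signs do not change.
    set a : ZMod 2 := σ e + s (u e) + s (w e) with ha
    set s' : Q → ZMod 2 := fun q => s q + if Relation.EqvGen r (u e) q then a else 0 with hs'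
    have hmono : ∀ x y, Relation.EqvGen r x y → Relation.EqvGen (fun x y =>
        ∃ f ∈ insert e M, u f = x ∧ w f = y ∧ σ f + s' x + s' y = 0) x y := by
      intro x y h
      refine h.mono ?_
      rintro x y ⟨f, hf, rfl, rfl, h⟩
      refine ⟨f, Finset.mem_insert_of_mem hf, rfl, rfl, ?_⟩
      have hiff : Relation.EqvGen r (u e) (u f) ↔ Relation.EqvGen r (u e) (w f) :=
        ⟨fun h => h.trans _ _ _ (hs f hf), fun h => h.trans _ _ _ ((hs f hf).symm _ _)⟩
      have h2 := zmod_two_add_self (if Relation.EqvGen r (u e) (w f) then a else 0)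
      simp only [hs', hiff]
      linear_combination h + h2
    refine ⟨s', fun f hf => ?_⟩
    rcases Finset.mem_insert.1 hf with rfl | hf
    · refine Relation.EqvGen.rel _ _ ⟨f, Finset.mem_insert_self _ _, rfl, rfl, ?_⟩
      simp only [hs', if_pos (Relation.EqvGen.refl (u f)), if_neg hc]
      have h2 := zmod_two_add_self a
      linear_combination h2
    · exact hmono _ _ (hs f hf)

end Joins

end Graph

namespace Graph

/-! ### Labellings with even label classes -/

section Labelling

variable {β Q : Type*}

/-- The permutation of the colors which exchanges `0` and `1` if `s = 1`. -/
def colorSwitch (s : ZMod 2) : Equiv.Perm (Fin 3) := if s = 0 then 1 else Equiv.swap 0 1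

lemma colorSwitch_eq_two_iff : ∀ (s : ZMod 2) (a : Fin 3), colorSwitch s a = 2 ↔ a = 2 := by
  decide

/-- Translates signs into colors: an edge is positive when its ends agree, and switching vertices
amounts to exchanging the colors `0` and `1` there. -/
lemma colorSwitch_eq_iff : ∀ (a b : Fin 3) (s t : ZMod 2), a ≠ 2 → b ≠ 2 →
    ((if a = b then (0 : ZMod 2) else 1) + s + t = 0 ↔ colorSwitch s a = colorSwitch t b) := by
  decide

lemma exists_three_labelling [DecidableEq β] {M X Y : Finset β} (hY : Y ⊆ M) (hX : X ⊆ M)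
    (hXY : Disjoint X Y) : ∃ l : β → Fin 3, (∀ e ∈ X, l e = 2) ∧ (∀ e ∈ Y, l e = 1) ∧
      (∀ e, e ∉ X → e ∉ Y → l e = 0) ∧ M.filter (fun e => l e = 0) = M \ (X ∪ Y) ∧
      M.filter (fun e => l e = 1) = Y ∧ M.filter (fun e => l e = 2) = X := by
  have h2 : ∀ e ∈ X, (if e ∈ X then (2 : Fin 3) else if e ∈ Y then 1 else 0) = 2 :=
    fun e he => if_pos he
  have h1 : ∀ e ∈ Y, (if e ∈ X then (2 : Fin 3) else if e ∈ Y then 1 else 0) = 1 :=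
    fun e he => by rw [if_neg (Finset.disjoint_right.1 hXY he), if_pos he]
  have h0 : ∀ e, e ∉ X → e ∉ Y → (if e ∈ X then (2 : Fin 3) else if e ∈ Y then 1 else 0) = 0 :=
    fun e he he' => by rw [if_neg he, if_neg he']
  refine ⟨_, h2, h1, h0, ?_, ?_, ?_⟩
  · ext e
    by_cases hx : e ∈ X
    · simp [hx]
    · by_cases hy : e ∈ Y <;> simp [hx, hy]
  · ext e
    by_cases hx : e ∈ X
    · simp [hx, Finset.disjoint_left.1 hXY hx]
    · by_cases hy : e ∈ Y
      · simp [hx, hy, hY hy]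
      · simp [hx, hy]
  · ext e
    by_cases hx : e ∈ X
    · simp [hx, hX hx]
    · by_cases hy : e ∈ Y <;> simp [hx, hy]

/-- Among the edges with no end colored `2`, switch so that the ends of every negative edge are
joined by positive edges. The negative edges together with a suitable set of positive ones then form
an even set `X`, which takes label `2`. Any other edge with no end colored `2` has equal end colors.
Label `1` is forced on the set `Y₀` of remaining edges with an end colored `0`. Edges with both ends
colored `2` may take label `0` or `1`; as they connect `R`, they can repair the parity of `Y₀`. The
rest gets label `0` and is even because `M` is. -/
lemma exists_labelling_of_special_two [Fintype Q] (M : Finset β) (u w : β → Q)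
    (ku kw : β → Fin 3) (R : Finset Q)
    (h0 : ∀ e ∈ M, (u e ∉ R → ku e = 0) ∧ (w e ∉ R → kw e = 0))
    (hconn : ∀ x ∈ R, ∀ y ∈ R, Relation.EqvGen
      (fun x y => ∃ e ∈ M, u e = x ∧ w e = y ∧ ku e = 2 ∧ kw e = 2) x y)
    (heven : ∀ q, bd u w M q = 0) :
    ∃ s : Q → ZMod 2, ∃ l : β → Fin 3,
      (∀ e ∈ M, l e ≠ colorSwitch (s (u e)) (ku e) ∧ l e ≠ colorSwitch (s (w e)) (kw e)) ∧
      ∀ i q, bd u w (M.filter (fun e => l e = i)) q = 0 := by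
  classical
  set P := M.filter (fun e => ku e ≠ 2 ∧ kw e ≠ 2) with hP
  obtain ⟨s, hs⟩ := exists_switching P u w (fun e => if ku e = kw e then 0 else 1)
  set cu : β → Fin 3 := fun e => colorSwitch (s (u e)) (ku e) with hcu
  set cw : β → Fin 3 := fun e => colorSwitch (s (w e)) (kw e) with hcw
  have hcu2 : ∀ e, cu e = 2 ↔ ku e = 2 := fun e => colorSwitch_eq_two_iff _ _
  have hcw2 : ∀ e, cw e = 2 ↔ kw e = 2 := fun e => colorSwitch_eq_two_iff _ _
  set pos := P.filter (fun e => cu e = cw e) with hpos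
  set neg := P.filter (fun e => ¬ cu e = cw e) with hneg
  have hmem : (fun q => bd u w neg q) ∈ bdSpan u w pos := by
    have : (fun q => bd u w neg q) = ∑ e ∈ neg, bdry (u e) (w e) := by
      funext q
      simp [bd]
    rw [this]
    refine Submodule.sum_mem _ fun e he => ?_
    refine bdry_mem_of_eqvGen ?_ (hs e (Finset.mem_filter.1 he).1)
    rintro x y ⟨f, hf, rfl, rfl, h⟩
    have hf2 := (Finset.mem_filter.1 hf).2
    exact bdry_mem_bdSpan (Finset.mem_filter.2
      ⟨hf, (colorSwitch_eq_iff _ _ _ _ hf2.1 hf2.2).1 h⟩)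
  obtain ⟨J, hJ, hJb⟩ := exists_bd_eq_of_mem_bdSpan hmem
  set X := neg ∪ J with hX
  have hXP : X ⊆ P := Finset.union_subset (Finset.filter_subset _ _)
    (hJ.trans (Finset.filter_subset _ _))
  have hXM : X ⊆ M := hXP.trans (Finset.filter_subset _ _)
  have hXb : ∀ q, bd u w X q = 0 := by
    intro q
    rw [hX, bd_union ((Finset.disjoint_filter_filter_not P P _).symm.mono_right hJ), hJb,
      zmod_two_add_self]
  have hP2 : ∀ e ∈ P, cu e ≠ 2 ∧ cw e ≠ 2 := fun e he => by
    rw [Ne, Ne, hcu2, hcw2]; exact (Finset.mem_filter.1 he).2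
  have hmix : ∀ e ∈ M, e ∉ X → cu e ≠ 2 → cw e ≠ 2 → cu e = cw e := by
    intro e he heX h1 h2
    by_contra h
    refine heX (Finset.mem_union_left _ (Finset.mem_filter.2 ⟨Finset.mem_filter.2 ⟨he, ?_⟩, h⟩))
    rw [Ne, Ne, ← hcu2, ← hcw2]; exact ⟨h1, h2⟩
  set Y₀ := (M \ X).filter (fun e => cu e = 0 ∨ cw e = 0) with hY₀
  set Z := M.filter (fun e => ku e = 2 ∧ kw e = 2) with hZ
  have hYZ : Disjoint Y₀ Z := by
    refine Finset.disjoint_left.2 fun e h1 h2 => ?_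
    have h1 := (Finset.mem_filter.1 h1).2
    have h2 := (Finset.mem_filter.1 h2).2
    rw [← hcu2, ← hcw2] at h2
    rw [h2.1, h2.2] at h1
    exact absurd h1 (by decide)
  have hXZ : Disjoint X Z := by
    refine Finset.disjoint_left.2 fun e h1 h2 => ?_
    exact (Finset.mem_filter.1 (hXP h1)).2.1 (Finset.mem_filter.1 h2).2.1
  have hout : ∀ q, q ∉ R → bd u w Y₀ q = 0 := by
    intro q hq
    have hu : ∀ e ∈ M, u e = q → cu e = colorSwitch (s q) 0 := by
      rintro e he rfl
      simp only [hcu, (h0 e he).1 hq]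
    have hw : ∀ e ∈ M, w e = q → cw e = colorSwitch (s q) 0 := by
      rintro e he rfl
      simp only [hcw, (h0 e he).2 hq]
    -- All ends at `q` have the same color. If it is `0`, every edge of `M \ X` at `q` is in `Y₀`;
    -- if it is `1`, none is, since an edge with end colors `0` and `1` lies in `X`.
    by_cases hs0 : s q = 0
    · have hc : colorSwitch (s q) 0 = 0 := by rw [hs0]; rfl
      rw [hc] at hu hw
      have hsub : bd u w Y₀ q = bd u w (M \ X) q := by
        rw [hY₀, bd, bd, Finset.sum_filter]
        refine Finset.sum_congr rfl fun e he => ?_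
        have heM := (Finset.mem_sdiff.1 he).1
        split_ifs with h
        · rfl
        · push Not at h
          exact (bdry_of_ne (fun h' => h.1 (hu e heM h'.symm))
            (fun h' => h.2 (hw e heM h'.symm))).symm
      rw [hsub, bd_sdiff hXM, heven, hXb, add_zero]
    · have hc : colorSwitch (s q) 0 = 1 := by
        rw [colorSwitch, if_neg hs0]; rfl
      rw [hc] at hu hw
      refine Finset.sum_eq_zero fun e he => ?_
      obtain ⟨he1, he2⟩ := Finset.mem_filter.1 he
      obtain ⟨heM, heX⟩ := Finset.mem_sdiff.1 he1
      refine bdry_of_ne (fun h => ?_) (fun h => ?_)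
      · have h1 := hu e heM h.symm
        have h2 : cw e = 0 := he2.resolve_left (by rw [h1]; decide)
        have := hmix e heM heX (by rw [h1]; decide) (by rw [h2]; decide)
        rw [h1, h2] at this
        exact absurd this (by decide)
      · have h1 := hw e heM h.symm
        have h2 : cu e = 0 := he2.resolve_right (by rw [h1]; decide)
        have := hmix e heM heX (by rw [h2]; decide) (by rw [h1]; decide)
        rw [h1, h2] at this
        exact absurd this (by decide)
  have hmem2 : (fun q => bd u w Y₀ q) ∈ bdSpan u w Z := by
    refine mem_of_sum_fiber_eq_zero (fun _ => ()) R _ (fun q hq => ?_) (fun x y hx hy _ => ?_)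
      (fun _ => ?_)
    · by_contra h
      exact hq (hout q h)
    · have hmR : ∀ q, bd u w Y₀ q ≠ 0 → q ∈ R := fun q hq => by
        by_contra h
        exact hq (hout q h)
      refine bdry_mem_of_eqvGen ?_ (hconn x (hmR x hx) y (hmR y hy))
      rintro x y ⟨e, he, rfl, rfl, h⟩
      exact bdry_mem_bdSpan (Finset.mem_filter.2 ⟨he, h⟩)
    · rw [← sum_bd_eq_zero (u := u) (w := w) Y₀]
      simp only [Finset.filter_true]
      exact Finset.sum_subset (Finset.subset_univ _) fun q _ hq => hout q hq
  obtain ⟨J', hJ', hJb'⟩ := exists_bd_eq_of_mem_bdSpan hmem2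
  set Y := Y₀ ∪ J' with hY
  have hYb : ∀ q, bd u w Y q = 0 := by
    intro q
    rw [hY, bd_union (hYZ.mono_right hJ'), hJb', zmod_two_add_self]
  have hYM : Y ⊆ M := Finset.union_subset
    ((Finset.filter_subset _ _).trans Finset.sdiff_subset) (hJ'.trans (Finset.filter_subset _ _))
  have hXY : Disjoint X Y := by
    refine Finset.disjoint_union_right.2 ⟨?_, hXZ.mono_right hJ'⟩
    exact Finset.disjoint_sdiff.mono_right (Finset.filter_subset _ _)
  obtain ⟨l, hl2, hl1, hl0, hf0, hf1, hf2⟩ := exists_three_labelling hYM hXM hXY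
  refine ⟨s, l, fun e he => ?_, fun i q => ?_⟩
  · change l e ≠ cu e ∧ l e ≠ cw e
    by_cases h1 : e ∈ X
    · rw [hl2 e h1]
      exact ⟨(hP2 e (hXP h1)).1.symm, (hP2 e (hXP h1)).2.symm⟩
    by_cases h2 : e ∈ Y
    · rw [hl1 e h2]
      rcases Finset.mem_union.1 h2 with h2 | h2
      · have h2 := (Finset.mem_filter.1 h2).2
        have := hmix e he h1
        revert h2 this
        generalize cu e = a
        generalize cw e = b
        revert a b
        decide
      · have h2 := (Finset.mem_filter.1 (hJ' h2)).2
        rw [← hcu2, ← hcw2] at h2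
        rw [h2.1, h2.2]
        decide
    · rw [hl0 e h1 h2]
      have h3 : e ∉ Y₀ := fun h => h2 (Finset.mem_union_left _ h)
      have h4 : ¬ (cu e = 0 ∨ cw e = 0) := fun h =>
        h3 (Finset.mem_filter.2 ⟨Finset.mem_sdiff.2 ⟨he, h1⟩, h⟩)
      push Not at h4
      exact ⟨h4.1.symm, h4.2.symm⟩
  · have hi : i = 0 ∨ i = 1 ∨ i = 2 := by revert i; decide
    rcases hi with rfl | rfl | rfl
    · rw [hf0, bd_sdiff (Finset.union_subset hXM hYM), heven, bd_union hXY, hXb, hYb]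
      rfl
    · rw [hf1, hYb]
    · rw [hf2, hXb]

/-- Let the ends of the edges in `M` be colored with three colors, such that each vertex outside of
`R` sees one color only, and such that the edges both of whose ends have the special color `a q` of
their vertex `q ∈ R` connect `R`. If all vertices have even degree, then, after permuting colors
at each vertex, one can label each edge by a color different from the colors of its ends such that
each label appears an even number of times at each vertex. -/
lemma exists_labelling [Fintype Q] (M : Finset β) (u w : β → Q)
    (ku kw : β → Fin 3) (R : Finset Q) (a : Q → Fin 3)
    (h0 : ∀ e ∈ M, (u e ∉ R → ku e = a (u e)) ∧ (w e ∉ R → kw e = a (w e)))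
    (hconn : ∀ x ∈ R, ∀ y ∈ R, Relation.EqvGen
      (fun x y => ∃ e ∈ M, u e = x ∧ w e = y ∧ x ∈ R ∧ y ∈ R ∧
        ku e = a x ∧ kw e = a y) x y)
    (heven : ∀ q, bd u w M q = 0) :
    ∃ p : Q → Equiv.Perm (Fin 3), ∃ l : β → Fin 3,
      (∀ e ∈ M, l e ≠ p (u e) (ku e) ∧ l e ≠ p (w e) (kw e)) ∧
      ∀ i q, bd u w (M.filter (fun e => l e = i)) q = 0 := by
  classical
  set p₀ : Q → Equiv.Perm (Fin 3) := fun q =>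
    if q ∈ R then Equiv.swap (a q) 2 else Equiv.swap (a q) 0 with hp₀
  have hin : ∀ q ∈ R, p₀ q (a q) = 2 := fun q hq => by
    simp only [hp₀, if_pos hq, Equiv.swap_apply_left]
  have hout : ∀ q, q ∉ R → p₀ q (a q) = 0 := fun q hq => by
    simp only [hp₀, if_neg hq, Equiv.swap_apply_left]
  obtain ⟨s, l, h1, h2⟩ := exists_labelling_of_special_two M u w (fun e => p₀ (u e) (ku e))
    (fun e => p₀ (w e) (kw e)) R
    (fun e he => ⟨fun h => by rw [(h0 e he).1 h, hout _ h], fun h => by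
      rw [(h0 e he).2 h, hout _ h]⟩)
    (fun x hx y hy => (hconn x hx y hy).mono (by
      rintro x y ⟨e, he, rfl, rfl, hx, hy, h3, h4⟩
      exact ⟨e, he, rfl, rfl, by rw [h3, hin _ hx], by rw [h4, hin _ hy]⟩)) heven
  exact ⟨fun q => (p₀ q).trans (colorSwitch (s q)), l, h1, h2⟩

end Labelling

end Graph

namespace Graph

/-! ### Components -/

section Components

variable {α β : Type*} {G H L F : Graph α β} {e : β} {x y v : α}

/-- The component of `H` which contains `x`. -/
def compAt (H : Graph α β) (x : α) : Graph α β := H.induce {y | Relation.ReflTransGen H.Adj x y}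

lemma reflTransGen_adj_symm (h : Relation.ReflTransGen H.Adj x y) :
    Relation.ReflTransGen H.Adj y x := by
  induction h with
  | refl => exact Relation.ReflTransGen.refl
  | tail _ h ih => exact ih.head h.symm

lemma reach_mem (hx : x ∈ V(H)) (h : Relation.ReflTransGen H.Adj x y) : y ∈ V(H) := by
  induction h with
  | refl => exact hx
  | tail _ h _ => exact h.right_mem

lemma mem_compAt (H : Graph α β) (x : α) : x ∈ V(H.compAt x) := Relation.ReflTransGen.refl

lemma compAt_isComponent (hx : x ∈ V(H)) : (H.compAt x).IsComponent H := by
  refine ⟨IsClosedSubgraph.mk' (induce_le fun y hy => reach_mem hx hy) ?_, ⟨x, mem_compAt H x⟩, ?_⟩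
  · rintro e y ⟨z, hz⟩ hy
    exact ⟨y, z, hz, hy, Relation.ReflTransGen.tail hy hz.adj⟩
  · have key : ∀ y ∈ V(H.compAt x), Relation.ReflTransGen (H.compAt x).Adj x y := by
      intro y hy
      change Relation.ReflTransGen H.Adj x y at hy
      induction hy with
      | refl => exact Relation.ReflTransGen.refl
      | tail h1 h2 ih =>
        obtain ⟨e, he⟩ := h2
        exact ih.tail ⟨e, he, h1, h1.tail he.adj⟩
    intro y hy z hz
    exact (reflTransGen_adj_symm (key y hy)).trans (key z hz)

lemma IsComponent.incidenceSet_eq (hL : L.IsComponent H) (hv : v ∈ V(L)) :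
    L.incidenceSet v = H.incidenceSet v :=
  Set.ext fun _ => hL.1.inc_congr hv

lemma Connected.exists_inc (hL : L.Connected) (he : E(L).Nonempty) (hv : v ∈ V(L)) :
    ∃ e, L.Inc e v := by
  obtain ⟨e, he⟩ := he
  obtain ⟨x, y, hxy⟩ := exists_isLink_of_mem_edgeSet he
  rcases (hL.2 v hv x hxy.left_mem).cases_head with rfl | ⟨c, ⟨f, hf⟩, _⟩
  · exact ⟨e, hxy.inc_left⟩
  · exact ⟨f, hf.inc_left⟩

lemma degree_eq_ncard (hG : G.Loopless) (hHG : H ≤ G) (v : α) :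
    H.degree v = (H.incidenceSet v).ncard := by
  have : H.loopSet v = ∅ := Set.eq_empty_of_forall_notMem fun e he => by
    exact hG.not_isLoopAt e v (IsLoopAt.mono hHG he)
  rw [degree, this, Set.ncard_empty, add_zero]

lemma IsCubic.ncard_incidenceSet (hG : G.IsCubic) (hv : v ∈ V(G)) :
    (G.incidenceSet v).ncard = 3 := by
  rw [← degree_eq_ncard hG.loopless le_rfl, hG.degree_eq v hv]

lemma IsCubic.finite_incidenceSet (hG : G.IsCubic) (v : α) : (G.incidenceSet v).Finite :=
  hG.finite_edgeSet.subset (G.incidenceSet_subset_edgeSet v)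

end Components

/-! ### Even edge sets and cycle double covers -/

section EvenSets

variable {α β : Type*} {G : Graph α β} {A : Set β} {C : Graph α β}

/-- Every vertex is incident with an even number of edges in `A`. -/
def IsEvenSet (G : Graph α β) (A : Set β) : Prop :=
  A ⊆ E(G) ∧ ∀ v ∈ V(G), Even {e ∈ A | G.Inc e v}.ncard

lemma incidenceSet_restrict (v : α) : (G.restrict A).incidenceSet v = {e ∈ A | G.Inc e v} := by
  ext e
  simp [and_comm]

/-- Degrees in such a component are positive, even and at most three. -/
lemma IsCubic.isCycle_of_isEvenSet (hG : G.IsCubic) (hA : G.IsEvenSet A)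
    (hC : C.IsComponent (G.restrict A)) (hne : E(C).Nonempty) : C.IsCycle := by
  refine ⟨hC.2, fun v hv => ?_⟩
  have hvG : v ∈ V(G) := hC.1.le.vertexSet_mono hv
  rw [degree_eq_ncard hG.loopless (hC.1.le.trans restrict_le)]
  obtain ⟨e, he⟩ := hC.2.exists_inc hne hv
  have hsub : C.incidenceSet v ⊆ G.incidenceSet v :=
    fun f hf => hf.mono (hC.1.le.trans restrict_le)
  have h3 := Set.ncard_le_ncard hsub (hG.finite_incidenceSet v)
  have h0 : 0 < (C.incidenceSet v).ncard :=
    (Set.ncard_pos ((hG.finite_incidenceSet v).subset hsub)).2 ⟨e, he⟩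
  have hev := hA.2 v hvG
  rw [← incidenceSet_restrict, ← hC.incidenceSet_eq hv] at hev
  rw [hG.ncard_incidenceSet hvG] at h3
  obtain ⟨n, hn⟩ := hev
  omega

/-- A double cover is a set, so a cycle must not arise twice. If `C` came from both `A i` and `A j`,
the third edge `g` at a vertex of `C` would lie in some other `A l`. By parity `A l` contains a
further edge there, which belongs to `C` and is covered three times. -/
lemma IsCubic.not_isComponent_two {k : ℕ} (hG : G.IsCubic) {A : Fin k → Set β}
    (hA : ∀ i, G.IsEvenSet (A i)) (h2 : ∀ e ∈ E(G), {i | e ∈ A i}.ncard = 2) {i j : Fin k}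
    (hij : i ≠ j) (hi : C.IsComponent (G.restrict (A i))) (hj : C.IsComponent (G.restrict (A j)))
    (hne : E(C).Nonempty) : False := by
  obtain ⟨v, hv⟩ := hi.2.1
  have hvG : v ∈ V(G) := hi.1.le.vertexSet_mono hv
  have hCG := hi.1.le.trans restrict_le
  have hdeg := (hG.isCycle_of_isEvenSet (hA i) hi hne).2 v hv
  rw [degree_eq_ncard hG.loopless hCG] at hdeg
  have h3 := hG.ncard_incidenceSet hvG
  have hsub : C.incidenceSet v ⊆ G.incidenceSet v := fun f hf => hf.mono hCG
  have hlt : (C.incidenceSet v).ncard < (G.incidenceSet v).ncard := by omega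
  obtain ⟨g, hgG, hgC⟩ := Set.exists_mem_notMem_of_ncard_lt_ncard hlt
    ((hG.finite_incidenceSet v).subset hsub)
  have hins : G.incidenceSet v = insert g (C.incidenceSet v) := by
    refine (Set.eq_of_subset_of_ncard_le (Set.insert_subset hgG hsub) ?_
      (hG.finite_incidenceSet v)).symm
    rw [Set.ncard_insert_of_notMem hgC ((hG.finite_incidenceSet v).subset hsub)]
    omega
  have hnot : ∀ l, C.IsComponent (G.restrict (A l)) → g ∉ A l := fun l hl hg => by
    refine hgC ((hl.1.inc_congr hv).2 ?_)
    exact restrict_inc.2 ⟨hgG, hg⟩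
  obtain ⟨l, hl⟩ : {i | g ∈ A i}.Nonempty :=
    Set.nonempty_of_ncard_ne_zero (by rw [h2 g hgG.edge_mem]; decide)
  have hli : l ≠ i := fun h => hnot i hi (h ▸ hl)
  have hlj : l ≠ j := fun h => hnot j hj (h ▸ hl)
  obtain ⟨f, hf, hfg⟩ : ∃ f ∈ {e ∈ A l | G.Inc e v}, f ≠ g := by
    by_contra! h
    have : {e ∈ A l | G.Inc e v} = {g} :=
      Set.eq_singleton_iff_unique_mem.2 ⟨⟨hl, hgG⟩, h⟩
    have hev := (hA l).2 v hvG
    rw [this, Set.ncard_singleton] at hev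
    exact absurd hev (by decide)
  have hfC : C.Inc f v := by
    have : f ∈ G.incidenceSet v := hf.2
    rw [hins] at this
    exact this.resolve_left hfg
  have hfA : ∀ l, C.IsComponent (G.restrict (A l)) → f ∈ A l := fun l hl =>
    (restrict_inc.1 (hfC.mono hl.1.le)).2
  have hle : ({l, i, j} : Set (Fin k)).ncard ≤ {i | f ∈ A i}.ncard := by
    refine Set.ncard_le_ncard ?_ (Set.toFinite _)
    rintro m (rfl | rfl | rfl)
    exacts [hf.1, hfA _ hi, hfA _ hj]
  rw [h2 f hf.2.edge_mem, Set.ncard_eq_three.2 ⟨l, i, j, hli, hlj, hij, rfl⟩] at hle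
  omega

/-- In a cubic graph, even edge sets which cover each edge twice yield a cycle double cover. -/
theorem IsCubic.hasCycleDoubleCover_of_isEvenSet {k : ℕ} [NeZero k] (hG : G.IsCubic)
    {A : Fin k → Set β} (hA : ∀ i, G.IsEvenSet (A i))
    (h2 : ∀ e ∈ E(G), {i | e ∈ A i}.ncard = 2) : G.HasCycleDoubleCover k := by
  classical
  -- Restriction keeps all vertices, so isolated vertices are components too and have to be
  -- excluded.
  set S : Set (Graph α β) := {C | ∃ i, C.IsComponent (G.restrict (A i)) ∧ E(C).Nonempty} with hS
  refine ⟨S, ⟨?_, ?_⟩, fun C => if h : C ∈ S then h.choose else 0, ?_⟩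
  · rintro C ⟨i, hC, hne⟩
    exact ⟨hC.1.le.trans restrict_le, hG.isCycle_of_isEvenSet (hA i) hC hne⟩
  · intro e he
    obtain ⟨x, y, hxy⟩ := exists_isLink_of_mem_edgeSet he
    have hcomp : ∀ i, ((G.restrict (A i)).compAt x).IsComponent (G.restrict (A i)) :=
      fun i => compAt_isComponent hxy.left_mem
    have hmem : ∀ i, e ∈ A i → e ∈ E((G.restrict (A i)).compAt x) := fun i hi =>
      (hcomp i).1.closed (restrict_inc.2 ⟨hxy.inc_left, hi⟩) (mem_compAt _ x)
    obtain ⟨i, j, hij, hset⟩ := Set.ncard_eq_two.1 (h2 e he)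
    have hi : e ∈ A i := (hset.symm ▸ Set.mem_insert i {j} : i ∈ {i | e ∈ A i})
    have hj : e ∈ A j := (hset.symm ▸ Set.mem_insert_of_mem i rfl : j ∈ {i | e ∈ A i})
    refine Set.ncard_eq_two.2 ⟨(G.restrict (A i)).compAt x, (G.restrict (A j)).compAt x, ?_, ?_⟩
    · intro h
      exact hG.not_isComponent_two hA h2 hij (hcomp i) (h ▸ hcomp j) ⟨e, hmem i hi⟩
    · ext C
      constructor
      · rintro ⟨⟨l, hC, hne⟩, heC⟩
        have hel : e ∈ A l := (hC.1.le.edgeSet_mono heC).2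
        have hxC : x ∈ V(C) := ((hC.1.le.trans restrict_le).isLink_iff heC).2 hxy |>.left_mem
        have hCl : C = (G.restrict (A l)).compAt x := hC.eq_of_mem (hcomp l) hxC (mem_compAt _ x)
        have hl : l ∈ ({i, j} : Set (Fin k)) := hset ▸ hel
        rcases hl with rfl | rfl
        · exact Or.inl hCl
        · exact Or.inr hCl
      · rintro (rfl | rfl)
        · exact ⟨⟨i, hcomp i, e, hmem i hi⟩, hmem i hi⟩
        · exact ⟨⟨j, hcomp j, e, hmem j hj⟩, hmem j hj⟩
  · intro C hC D hD hCD hc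
    simp only [dif_pos hC, dif_pos hD] at hc
    have h1 := hC.choose_spec.1
    have h2 := hD.choose_spec.1
    rw [← hc] at h2
    refine Set.disjoint_left.2 fun e heC heD => hCD ?_
    obtain ⟨x, y, hxy⟩ := exists_isLink_of_mem_edgeSet heC
    exact h1.eq_of_mem h2 hxy.left_mem
      ((h2.1.le.isLink_iff heD).2 (hxy.mono h1.1.le)).left_mem

end EvenSets

end Graph

namespace Graph

/-! ### Colorings of the components of a frame -/

section FrameColoring

variable {α β γ : Type*} {G L : Graph α β} {K : Graph α γ}

/-- An edge coloring of a graph with vertices of degree `2` and `3` such that the edges avoiding any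
given color form an even subgraph without two nontrivial components, and such that both edges at a
vertex of degree `2` have the same color. -/
structure IsFrameColoring (L : Graph α β) (c : β → Fin 3) : Prop where
  even : ∀ v ∈ V(L), ∀ i, Even {e | L.Inc e v ∧ c e ≠ i}.ncard
  degree : ∀ v ∈ V(L),
    (L.incidenceSet v).ncard = 2 ∧ (∃ k, ∀ e, L.Inc e v → c e = k) ∨ (L.incidenceSet v).ncard = 3
  conn : ∀ i x y, (∃ e, L.Inc e x ∧ c e ≠ i) → (∃ e, L.Inc e y ∧ c e ≠ i) →
    Relation.ReflTransGen (fun a b => ∃ e, c e ≠ i ∧ L.IsLink e a b) x y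

/-- Lets the labelling permute the colors of each component independently. -/
lemma IsFrameColoring.perm {c : β → Fin 3} (h : L.IsFrameColoring c) (p : Equiv.Perm (Fin 3)) :
    L.IsFrameColoring (fun e => p (c e)) := by
  have hp : ∀ e i, p (c e) ≠ i ↔ c e ≠ p.symm i := fun e i => by
    rw [Ne, Ne, Equiv.eq_symm_apply]
  refine ⟨fun v hv i => ?_, fun v hv => ?_, fun i x y => ?_⟩
  · simp only [hp]
    exact h.even v hv _
  · refine (h.degree v hv).imp_left fun h => ⟨h.1, ?_⟩
    obtain ⟨k, hk⟩ := h.2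
    exact ⟨p k, fun e he => by rw [hk e he]⟩
  · simp only [hp]
    exact h.conn _ x y

lemma even_ncard_of_constant {s : Set β} {c : β → Fin 3} {k : Fin 3} (hk : ∀ e ∈ s, c e = k)
    (hs : s.ncard = 2) (i : Fin 3) : Even {e | e ∈ s ∧ c e ≠ i}.ncard := by
  by_cases hki : k = i
  · have : {e | e ∈ s ∧ c e ≠ i} = ∅ :=
      Set.eq_empty_of_forall_notMem fun e he => he.2 (hki ▸ hk e he.1)
    simp [this]
  · have : {e | e ∈ s ∧ c e ≠ i} = s :=
      Set.ext fun e => ⟨fun h => h.1, fun h => ⟨h, by rw [hk e h]; exact hki⟩⟩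
    rw [this, hs]
    exact even_two

lemma IsCycle.isFrameColoring (hL : L.IsCycle) (hl : L.Loopless) (k : Fin 3) :
    L.IsFrameColoring (fun _ => k) := by
  have hdeg : ∀ v ∈ V(L), (L.incidenceSet v).ncard = 2 := fun v hv => by
    rw [← degree_eq_ncard hl le_rfl, hL.2 v hv]
  refine ⟨fun v hv i => even_ncard_of_constant (s := L.incidenceSet v) (fun _ _ => rfl)
    (hdeg v hv) i, fun v hv => Or.inl ⟨hdeg v hv, k, fun _ _ => rfl⟩, ?_⟩
  rintro i x y ⟨e, hx, he⟩ ⟨f, hy, -⟩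
  exact Relation.ReflTransGen.mono (fun a b ⟨g, hg⟩ => ⟨g, he, hg⟩) _ _
    (hL.1.2 x hx.vertex_mem y hy.vertex_mem)

lemma IsKotzigColoring.ncard_ne {c : γ → Fin 3} (hc : K.IsKotzigColoring c) (hK : K.IsCubic)
    {v : α} (hv : v ∈ V(K)) (i : Fin 3) : {e | K.Inc e v ∧ c e ≠ i}.ncard = 2 := by
  have hinj : Set.InjOn c (K.incidenceSet v) := fun e he f hf h => by
    by_contra hne
    exact hc.proper e f v hne he hf h
  have himg : c '' K.incidenceSet v = Set.univ := by
    refine Set.eq_of_subset_of_ncard_le (Set.subset_univ _) ?_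
    rw [hinj.ncard_image, hK.ncard_incidenceSet hv, Set.ncard_univ]
    simp
  have hinj' : Set.InjOn c {e | K.Inc e v ∧ c e ≠ i} := hinj.mono fun e he => he.1
  have himg' : c '' {e | K.Inc e v ∧ c e ≠ i} = {i}ᶜ := by
    ext k
    constructor
    · rintro ⟨e, he, rfl⟩
      exact he.2
    · intro hk
      obtain ⟨e, he, rfl⟩ := himg.symm ▸ Set.mem_univ k
      exact ⟨e, ⟨he, hk⟩, rfl⟩
  rw [← hinj'.ncard_image, himg', Set.ncard_compl, Set.ncard_singleton]
  simp

/-- Two color classes form a `2`-regular graph, so the component of `x` is a two-colored cycle and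
therefore hamiltonian. -/
lemma IsKotzigColoring.reach {c : γ → Fin 3} (hc : K.IsKotzigColoring c) (hK : K.IsCubic)
    (i : Fin 3) {x y : α} (hx : x ∈ V(K)) (hy : y ∈ V(K)) :
    Relation.ReflTransGen (K.restrict {e | c e ≠ i}).Adj x y := by
  have hC := compAt_isComponent (H := K.restrict {e | c e ≠ i}) hx
  set C := (K.restrict {e | c e ≠ i}).compAt x with hCdef
  have hCK : C ≤ K := hC.1.le.trans restrict_le
  have hV := hc.hamiltonian C hCK ⟨hC.2, fun v hv => ?_⟩ ?_
  · rw [← hV] at hy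
    exact hy
  · rw [degree_eq_ncard hK.loopless hCK, hC.incidenceSet_eq hv, incidenceSet_restrict]
    have := hc.ncard_ne hK (hCK.vertexSet_mono hv) i
    rwa [Set.ofPred_and, Set.inter_comm] at this
  · have : ∀ i : Fin 3, ∃ a b : Fin 3, ∀ k, k ≠ i → k = a ∨ k = b := by
      decide
    obtain ⟨a, b, hab⟩ := this i
    exact ⟨a, b, fun e he => hab _ (hC.1.le.edgeSet_mono he).2⟩

/-- Each path inherits the color of the edge it replaces. An inner vertex then sees one color, the
edges at a branch vertex correspond to those of `K` with their colors, and a walk in two colors of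
`K` lifts path by path. -/
lemma IsSubdivision.exists_isFrameColoring (hL : L.IsSubdivision K) (hl : L.Loopless)
    (hK : K.IsCubic) {c : γ → Fin 3} (hc : K.IsKotzigColoring c) :
    ∃ c' : β → Fin 3, L.IsFrameColoring c' := by
  classical
  obtain ⟨P, hP, hdisj, hV, hE, -⟩ := hL
  have hle : ∀ e ∈ E(K), P e ≤ L := fun e he => by
    obtain ⟨x, y, h⟩ := exists_isLink_of_mem_edgeSet he
    exact (hP e x y h).1
  have hconn : ∀ e ∈ E(K), (P e).Connected := fun e he => by
    obtain ⟨x, y, h⟩ := exists_isLink_of_mem_edgeSet he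
    exact (hP e x y h).2.1.1
  have hmem : ∀ e ∈ E(K), ∀ v ∈ V(K), (v ∈ V(P e) ↔ K.Inc e v) := fun e he v hv => by
    obtain ⟨x, y, h⟩ := exists_isLink_of_mem_edgeSet he
    have h3 := (hP e x y h).2.2
    constructor
    · intro h4
      have : v ∈ ({x, y} : Set α) := h3 ▸ ⟨h4, hv⟩
      rcases this with rfl | rfl
      · exact h.inc_left
      · exact h.inc_right
    · intro h4
      have : v ∈ V(P e) ∩ V(K) := by
        rw [h3]
        exact h4.eq_or_eq_of_isLink h
      exact this.1
  have hdeg1 : ∀ e v, K.Inc e v → ∃ f, (P e).incidenceSet v = {f} := fun e v ⟨y, h⟩ => by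
    rw [← Set.ncard_eq_one, ← degree_eq_ncard hl (hle e h.edge_mem)]
    exact (hP e v y h).2.1.2.2.2.2.1
  have hdeg2 : ∀ e ∈ E(K), ∀ v ∈ V(P e), v ∉ V(K) → ((P e).incidenceSet v).ncard = 2 :=
    fun e he v hv hvK => by
    obtain ⟨x, y, h⟩ := exists_isLink_of_mem_edgeSet he
    rw [← degree_eq_ncard hl (hle e he)]
    exact (hP e x y h).2.1.2.2.2.2.2.2 v hv (fun h' => hvK (h' ▸ h.left_mem))
      (fun h' => hvK (h' ▸ h.right_mem))
  have hinc : ∀ f v, L.Inc f v ↔ ∃ e ∈ E(K), (P e).Inc f v := fun f v => by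
    constructor
    · intro h
      have := h.edge_mem
      rw [hE] at this
      obtain ⟨e, he, hf⟩ := Set.mem_iUnion₂.1 this
      exact ⟨e, he, ((hle e he).inc_congr hf).2 h⟩
    · rintro ⟨e, he, h⟩
      exact h.mono (hle e he)
  have huniq : ∀ e ∈ E(K), ∀ e' ∈ E(K), ∀ f, f ∈ E(P e) → f ∈ E(P e') → e = e' :=
    fun e he e' he' f h h' => by
    by_contra hne
    exact Set.disjoint_left.1 (hdisj e he e' he' hne).1 h h'
  obtain ⟨c', hc'⟩ : ∃ c' : β → Fin 3, ∀ e ∈ E(K), ∀ f ∈ E(P e), c' f = c e := by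
    refine ⟨fun f => if h : ∃ e ∈ E(K), f ∈ E(P e) then c h.choose else 0, fun e he f hf => ?_⟩
    have h : ∃ e ∈ E(K), f ∈ E(P e) := ⟨e, he, hf⟩
    simp only [dif_pos h]
    rw [huniq _ h.choose_spec.1 e he f h.choose_spec.2 hf]
  have hin : ∀ v ∈ V(L), v ∉ V(K) → ∃ e ∈ E(K), L.incidenceSet v = (P e).incidenceSet v ∧
      (L.incidenceSet v).ncard = 2 := by
    intro v hv hvK
    rw [hV] at hv
    obtain ⟨e, he, hve⟩ := Set.mem_iUnion₂.1 (hv.resolve_left hvK)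
    have heq : L.incidenceSet v = (P e).incidenceSet v := by
      ext f
      refine ⟨fun h => ?_, fun h => h.mono (hle e he)⟩
      obtain ⟨e', he', h'⟩ := (hinc f v).1 h
      by_cases hee : e' = e
      · exact hee ▸ h'
      · exact absurd ((hdisj e' he' e he hee).2 ⟨h'.vertex_mem, hve⟩) hvK
    exact ⟨e, he, heq, by rw [heq, hdeg2 e he v hve hvK]⟩
  have hbranch : ∀ v ∈ V(K), ∀ p : Fin 3 → Prop,
      {f | L.Inc f v ∧ p (c' f)}.ncard = {e | K.Inc e v ∧ p (c e)}.ncard := by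
    intro v hv p
    have : Nonempty β := by
      obtain ⟨e, he⟩ : (K.incidenceSet v).Nonempty :=
        Set.nonempty_of_ncard_ne_zero (by rw [hK.ncard_incidenceSet hv]; decide)
      exact ⟨(hdeg1 e v he).choose⟩
    -- `φ e v` is the unique edge of the path `P e` at its end `v`.
    choose! φ hφ using hdeg1
    have hφ' : ∀ e, K.Inc e v → (P e).Inc (φ e v) v := fun e he => by
      have : φ e v ∈ (P e).incidenceSet v := by rw [hφ e v he]; rfl
      exact this
    have hinj : Set.InjOn (fun e => φ e v) {e | K.Inc e v ∧ p (c e)} := by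
      intro e he e' he' h
      refine huniq e he.1.edge_mem e' he'.1.edge_mem _ (hφ' e he.1).edge_mem ?_
      have h : φ e v = φ e' v := h
      rw [h]
      exact (hφ' e' he'.1).edge_mem
    rw [← hinj.ncard_image]
    congr 1
    ext f
    constructor
    · rintro ⟨h, hp⟩
      obtain ⟨e, he, h'⟩ := (hinc f v).1 h
      have hev := (hmem e he v hv).1 h'.vertex_mem
      refine ⟨e, ⟨hev, by rwa [← hc' e he f h'.edge_mem]⟩, ?_⟩
      have : f ∈ (P e).incidenceSet v := h'
      rw [hφ e v hev] at this
      exact this.symm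
    · rintro ⟨e, ⟨he, hp⟩, rfl⟩
      exact ⟨(hinc _ _).2 ⟨e, he.edge_mem, hφ' e he⟩, by
        rwa [hc' e he.edge_mem _ (hφ' e he).edge_mem]⟩
  refine ⟨c', fun v hv i => ?_, fun v hv => ?_, fun i x y hx hy => ?_⟩
  · by_cases hvK : v ∈ V(K)
    · rw [hbranch v hvK (fun k => k ≠ i), hc.ncard_ne hK hvK]
      exact even_two
    · obtain ⟨e, he, h1, h2⟩ := hin v hv hvK
      refine even_ncard_of_constant (s := L.incidenceSet v) (k := c e) (fun f hf => ?_) h2 i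
      rw [h1] at hf
      exact hc' e he f hf.edge_mem
  · by_cases hvK : v ∈ V(K)
    · right
      have := hbranch v hvK (fun _ => True)
      simp only [and_true] at this
      exact this.trans (hK.ncard_incidenceSet hvK)
    · obtain ⟨e, he, h1, h2⟩ := hin v hv hvK
      refine Or.inl ⟨h2, c e, fun f hf => ?_⟩
      have hf : f ∈ L.incidenceSet v := hf
      rw [h1] at hf
      exact hc' e he f hf.edge_mem
  · set r : α → α → Prop := fun a b => ∃ e, c' e ≠ i ∧ L.IsLink e a b with hr
    have hsegment : ∀ e ∈ E(K), c e ≠ i → ∀ a ∈ V(P e), ∀ b ∈ V(P e),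
        Relation.ReflTransGen r a b := fun e he hei a ha b hb =>
      Relation.ReflTransGen.mono (fun a b ⟨f, hf⟩ =>
        ⟨f, by rwa [hc' e he f hf.edge_mem], hf.mono (hle e he)⟩) _ _ ((hconn e he).2 a ha b hb)
    have hend : ∀ x, (∃ f, L.Inc f x ∧ c' f ≠ i) → ∃ z ∈ V(K),
        Relation.ReflTransGen r x z ∧ Relation.ReflTransGen r z x := by
      rintro x ⟨f, hf, hfi⟩
      obtain ⟨e, he, hfe⟩ := (hinc f x).1 hf
      rw [hc' e he f hfe.edge_mem] at hfi
      obtain ⟨z, z', hz⟩ := exists_isLink_of_mem_edgeSet he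
      have hzP := (hmem e he z hz.left_mem).2 hz.inc_left
      exact ⟨z, hz.left_mem, hsegment e he hfi x hfe.vertex_mem z hzP,
        hsegment e he hfi z hzP x hfe.vertex_mem⟩
    obtain ⟨x', hx', hxx', -⟩ := hend x hx
    obtain ⟨y', hy', -, hyy'⟩ := hend y hy
    refine hxx'.trans (Relation.ReflTransGen.trans ?_ hyy')
    have := hc.reach hK i hx' hy'
    clear hxx' hyy' hy'
    induction this with
    | refl => exact Relation.ReflTransGen.refl
    | tail _ h ih =>
      obtain ⟨e, hei, he⟩ := h
      exact ih.trans (hsegment e he.edge_mem hei _ ((hmem e he.edge_mem _ he.left_mem).2 he.inc_left)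
        _ ((hmem e he.edge_mem _ he.right_mem).2 he.inc_right))

end FrameColoring

end Graph

namespace Graph

/-! ### Double covers from frames -/

section Frames

variable {α β : Type*} {G F : Graph α β}

lemma bd_eq_ncard (hG : G.Loopless) {p r : β → α} (hpr : ∀ e ∈ E(G), G.IsLink e (p e) (r e))
    {A : Finset β} (hA : ↑A ⊆ E(G)) (v : α) :
    bd p r A v = ({e | e ∈ A ∧ G.Inc e v}.ncard : ZMod 2) := by
  classical
  have h1 : ∀ e ∈ A, bdry (p e) (r e) v = if G.Inc e v then 1 else 0 := by
    intro e he
    have hl := hpr e (hA he)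
    have hne : p e ≠ r e := hl.ne
    have hiff : G.Inc e v ↔ v = p e ∨ v = r e :=
      ⟨fun h => h.eq_or_eq_of_isLink hl, by rintro (rfl | rfl); exacts [hl.inc_left, hl.inc_right]⟩
    simp only [bdry, hiff]
    by_cases h1 : v = p e
    · have h2 : v ≠ r e := fun h => hne (h1 ▸ h)
      simp [h1, hne]
    · simp [h1]
  rw [bd, Finset.sum_congr rfl h1, Finset.sum_boole]
  congr 1
  rw [← Set.ncard_coe_finset]
  congr 1
  ext e
  simp

/-- Boundaries commute with contraction, which carries parity statements between `G` and the
contracted graph. -/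
lemma sum_fiber_bd {Q : Type*} [DecidableEq Q] {W : Finset α} (g : α → Q) {p r : β → α}
    {A : Finset β} (hW : ∀ e ∈ A, p e ∈ W ∧ r e ∈ W) (q : Q) :
    ∑ v ∈ W with g v = q, bd p r A v = bd (g ∘ p) (g ∘ r) A q := by
  simp only [bd]
  rw [Finset.sum_comm]
  refine Finset.sum_congr rfl fun e he => ?_
  have := sum_fiber_bdry g (hW e he).1 (hW e he).2 q
  simp only [Function.comp_apply]
  convert this

lemma even_ncard_iff_bd (hG : G.Loopless) {p r : β → α}
    (hpr : ∀ e ∈ E(G), G.IsLink e (p e) (r e)) {A : Finset β} (hA : ↑A ⊆ E(G)) (v : α) :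
    Even {e | e ∈ A ∧ G.Inc e v}.ncard ↔ bd p r A v = 0 := by
  rw [bd_eq_ncard hG hpr hA, ZMod.natCast_eq_zero_iff_even]

/-- Pairs of even edge sets obtained by joins: if the ends of the edges in `N i` can be joined
inside `H i`, then `N i` is covered twice and `H i` once by two even edge sets. -/
lemma IsCubic.hasCycleDoubleCover_of_join (hG : G.IsCubic) {p r : β → α}
    (hpr : ∀ e ∈ E(G), G.IsLink e (p e) (r e)) (M E : Finset β) (hME : Disjoint M E)
    (hcov : (↑M ∪ ↑E : Set β) = E(G)) (l c : β → Fin 3)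
    (heven : ∀ i v, bd p r (E.filter (fun e => c e ≠ i)) v = 0)
    (hjoin : ∀ i, (fun v => bd p r (M.filter (fun e => l e = i)) v) ∈
      bdSpan p r (E.filter (fun e => c e ≠ i))) :
    G.HasCycleDoubleCover 6 := by
  classical
  have hJ := fun i => exists_bd_eq_of_mem_bdSpan (hjoin i)
  choose J hJsub hJb using hJ
  set N : Fin 3 → Finset β := fun i => M.filter (fun e => l e = i) with hN
  set H : Fin 3 → Finset β := fun i => E.filter (fun e => c e ≠ i) with hH
  have hNM : ∀ i, N i ⊆ M := fun i => Finset.filter_subset _ _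
  have hHE : ∀ i, H i ⊆ E := fun i => Finset.filter_subset _ _
  set A : Fin 3 × Fin 2 → Finset β := fun x =>
    if x.2 = 0 then N x.1 ∪ J x.1 else N x.1 ∪ (H x.1 \ J x.1) with hA
  have hAsub : ∀ x, ↑(A x) ⊆ E(G) := by
    intro x e he
    rw [← hcov]
    simp only [hA] at he
    split_ifs at he
    · rcases Finset.mem_union.1 he with h | h
      · exact Or.inl (hNM _ h)
      · exact Or.inr (hHE _ (hJsub _ h))
    · rcases Finset.mem_union.1 he with h | h
      · exact Or.inl (hNM _ h)
      · exact Or.inr (hHE _ (Finset.sdiff_subset h))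
  have hAb : ∀ x v, bd p r (A x) v = 0 := by
    intro x v
    simp only [hA]
    split_ifs
    · rw [bd_union (hME.mono (hNM _) ((hJsub _).trans (hHE _))), hJb, zmod_two_add_self]
    · rw [bd_union (hME.mono (hNM _) (Finset.sdiff_subset.trans (hHE _))), bd_sdiff (hJsub _), hJb,
        heven, zero_add, zmod_two_add_self]
  have hmem : ∀ e x, e ∈ A x ↔ (e ∈ M ∧ l e = x.1) ∨
      (e ∈ E ∧ c e ≠ x.1 ∧ x.2 = if e ∈ J x.1 then 0 else 1) := by
    rintro e ⟨i, j⟩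
    have hj : j = 0 ∨ j = 1 := by revert j; decide
    have hJH : e ∈ J i → e ∈ E ∧ c e ≠ i := fun h => Finset.mem_filter.1 (hJsub i h)
    rcases hj with rfl | rfl
    · by_cases heJ : e ∈ J i
      · simp [hA, hN, heJ, hJH heJ]
      · simp [hA, hN, heJ]
    · by_cases heJ : e ∈ J i
      · simp [hA, hN, heJ]
      · simp [hA, hN, hH, heJ]
  have hcount : ∀ e ∈ E(G), {x | e ∈ A x}.ncard = 2 := by
    intro e he
    rw [← hcov] at he
    rcases he with he | he
    · have hE : e ∉ E := Finset.disjoint_left.1 hME he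
      refine Set.ncard_eq_two.2 ⟨(l e, 0), (l e, 1), by simp, ?_⟩
      ext ⟨i, j⟩
      have he' : e ∈ M := he
      simp only [Set.mem_ofPred_eq, hmem, hE, he', true_and, false_and, or_false,
        Set.mem_insert_iff, Set.mem_singleton_iff, Prod.mk.injEq]
      have hj : j = 0 ∨ j = 1 := by revert j; decide
      constructor
      · rintro rfl
        exact hj.imp (fun h => ⟨rfl, h⟩) (fun h => ⟨rfl, h⟩)
      · rintro (h | h) <;> exact h.1.symm
    · have hM : e ∉ M := Finset.disjoint_right.1 hME he
      -- A frame edge belongs to `H m` for the two values `m` other than its color, and then to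
      -- exactly one of `J m` and `H m \ J m`.
      have h2 : ∀ k : Fin 3, ∃ i j, i ≠ j ∧ ∀ m, k ≠ m ↔ m = i ∨ m = j := by decide
      obtain ⟨i, j, hij, hk⟩ := h2 (c e)
      refine Set.ncard_eq_two.2 ⟨(i, if e ∈ J i then 0 else 1), (j, if e ∈ J j then 0 else 1),
        fun h => hij (Prod.ext_iff.1 h).1, ?_⟩
      ext ⟨m, n⟩
      have he' : e ∈ E := he
      simp only [Set.mem_ofPred_eq, hmem, hM, he', true_and, false_and, false_or, hk,
        Set.mem_insert_iff, Set.mem_singleton_iff, Prod.mk.injEq]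
      constructor
      · rintro ⟨rfl | rfl, h⟩
        · exact Or.inl ⟨rfl, h⟩
        · exact Or.inr ⟨rfl, h⟩
      · rintro (⟨rfl, h⟩ | ⟨rfl, h⟩)
        · exact ⟨Or.inl rfl, h⟩
        · exact ⟨Or.inr rfl, h⟩
  let φ : Fin 6 ≃ Fin 3 × Fin 2 := (finProdFinEquiv (m := 3) (n := 2)).symm
  refine hG.hasCycleDoubleCover_of_isEvenSet (A := fun k => ↑(A (φ k)))
    (fun k => ⟨hAsub _, fun v _ => ?_⟩) (fun e he => ?_)
  · exact (even_ncard_iff_bd hG.loopless hpr (hAsub _) v).2 (hAb _ v)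
  · refine Eq.trans ?_ (hcount e he)
    rw [← Set.ncard_image_of_injective _ φ.injective]
    congr 1
    ext x
    constructor
    · rintro ⟨k, hk, rfl⟩
      exact hk
    · intro hx
      exact ⟨φ.symm x, by simpa using hx, by simp⟩

end Frames

end Graph

namespace Graph

/-! ### Double covers from a connected set of components -/

section Main

variable {α β : Type*} {G F : Graph α β}

/-- A frame all of whose components have an even number of vertices and suitable colorings yields a
`6`-cycle double cover, provided that some set `R` of components which contains all components
other than cycles is connected by a set `D` of edges of the contracted graph which meets each
component other than a cycle in at most one vertex. -/
theorem IsCubic.hasCycleDoubleCover_of_frame (hG : G.IsCubic) (hne : V(G).Nonempty)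
    (hF : F.IsKotzigFrame G) (R : Set (Graph α β)) (D : Set β)
    (hR : ∀ L, L.IsComponent F → L ∉ R → L.IsCycle)
    (hconn : ∀ X ∈ R, ∀ Y ∈ R, X.IsComponent F → Y.IsComponent F → Relation.EqvGen
      (fun X Y => X ∈ R ∧ Y ∈ R ∧ ∃ e ∈ D, (G.contractFrame F).IsLink e X Y) X Y)
    (hD : ∀ X, X.IsComponent F → ¬ X.IsCycle → ∃ x, ∀ e ∈ D, ∀ y ∈ V(X), G.Inc e y → y = x) :
    G.HasCycleDoubleCover 6 := by
  classical
  have hFG : F ≤ G := hF.spanning.le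
  have hVF : V(F) = V(G) := hF.spanning.vertexSet_eq
  have hcomp : ∀ v ∈ V(G), (F.compAt v).IsComponent F := fun v hv =>
    compAt_isComponent (hVF ▸ hv)
  obtain ⟨v₀, hv₀⟩ := hne
  let Q := {L : Graph α β // L.IsComponent F}
  -- The contraction map; its value outside of `V(G)` is arbitrary.
  let g : α → Q := fun v => if hv : v ∈ V(G) then ⟨F.compAt v, hcomp v hv⟩
    else ⟨F.compAt v₀, hcomp v₀ hv₀⟩
  have hg : ∀ v ∈ V(G), v ∈ V((g v).1) := fun v hv => by
    simp only [g, dif_pos hv]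
    exact mem_compAt F v
  have hgeq : ∀ (L : Q) v, v ∈ V(L.1) → g v = L := fun L v hv =>
    Subtype.ext ((g v).2.eq_of_mem L.2 (hg v (hVF ▸ L.2.1.le.vertexSet_mono hv)) hv)
  have hQle : ∀ L : Q, L.1 ≤ G := fun L => L.2.1.le.trans hFG
  have : Finite Q := by
    have : (g '' V(G)) = Set.univ := by
      refine Set.eq_univ_of_forall fun L => ?_
      obtain ⟨v, hv⟩ := L.2.2.1
      exact ⟨v, (hQle L).vertexSet_mono hv, hgeq L v hv⟩
    exact Set.finite_univ_iff.1 (this ▸ hG.finite_vertexSet.image g)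
  have := Fintype.ofFinite Q
  -- colorings of the components
  have hcol : ∀ L : Q, ∃ c : β → Fin 3, L.1.IsFrameColoring c ∧ (L.1.IsCycle → ∀ e, c e = 0) := by
    intro L
    have hl : L.1.Loopless := ⟨fun e x h => hG.loopless.not_isLoopAt e x (h.mono (hQle L))⟩
    by_cases hC : L.1.IsCycle
    · exact ⟨_, hC.isFrameColoring hl 0, fun _ _ => rfl⟩
    · obtain ⟨K, ⟨hK, c, hc⟩, hs⟩ := (hF.cycle_or_subdivision L.1 L.2).resolve_left hC
      obtain ⟨c', hc'⟩ := hs.exists_isFrameColoring hl hK hc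
      exact ⟨c', hc', fun h => absurd h hC⟩
  choose c hc hc0 using hcol
  have hinc : ∀ v ∈ V(G), ∀ e, (g v).1.Inc e v ↔ F.Inc e v := fun v hv e =>
    (g v).2.1.inc_congr (hg v hv)
  -- The common color of the two frame edges at a vertex of degree two in `F`, arbitrary at other
  -- vertices.
  have hkv : ∀ v, ∃ k, v ∈ V(G) → ((g v).1.incidenceSet v).ncard = 2 →
      ∀ e, F.Inc e v → c (g v) e = k := by
    intro v
    by_cases hv : v ∈ V(G)
    · rcases (hc (g v)).degree v (hg v hv) with ⟨-, k, hk⟩ | h3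
      · exact ⟨k, fun _ _ e he => hk e ((hinc v hv e).2 he)⟩
      · exact ⟨0, fun _ h2 => by omega⟩
    · exact ⟨0, fun h => absurd h hv⟩
  choose κ hκ using hkv
  -- the edges and their ends
  have hends : ∀ e, ∃ x : α × α, e ∈ E(G) → G.IsLink e x.1 x.2 := fun e => by
    by_cases he : e ∈ E(G)
    · obtain ⟨x, y, h⟩ := exists_isLink_of_mem_edgeSet he
      exact ⟨(x, y), fun _ => h⟩
    · exact ⟨(v₀, v₀), fun h => absurd h he⟩
  choose pr hpr using hends
  set p : β → α := fun e => (pr e).1 with hp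
  set r : β → α := fun e => (pr e).2 with hr
  have hpr : ∀ e ∈ E(G), G.IsLink e (p e) (r e) := hpr
  set EG := hG.finite_edgeSet.toFinset with hEG
  set E := EG.filter (fun e => e ∈ E(F)) with hE
  set M := EG.filter (fun e => e ∉ E(F)) with hM
  have hmemEG : ∀ e, e ∈ EG ↔ e ∈ E(G) := fun e => hG.finite_edgeSet.mem_toFinset
  have hmemE : ∀ e, e ∈ E ↔ e ∈ E(F) := fun e => by
    rw [hE, Finset.mem_filter, hmemEG]
    exact ⟨fun h => h.2, fun h => ⟨hFG.edgeSet_mono h, h⟩⟩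
  have hmemM : ∀ e, e ∈ M ↔ e ∈ E(G) ∧ e ∉ E(F) := fun e => by
    rw [hM, Finset.mem_filter, hmemEG]
  have hME : Disjoint M E := (Finset.disjoint_filter_filter_not EG EG _).symm
  have hEGM : EG = M ∪ E := by
    rw [Finset.union_comm]
    exact (Finset.filter_union_filter_not_eq _ _).symm
  set W := hG.finite_vertexSet.toFinset with hW
  have hmemW : ∀ v, v ∈ W ↔ v ∈ V(G) := fun v => hG.finite_vertexSet.mem_toFinset
  have hendsW : ∀ A : Finset β, ↑A ⊆ E(G) → ∀ e ∈ A, p e ∈ W ∧ r e ∈ W := fun A hA e he =>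
    ⟨(hmemW _).2 (hpr e (hA he)).left_mem, (hmemW _).2 (hpr e (hA he)).right_mem⟩
  have hgF : ∀ e x y, F.IsLink e x y → g x = g y := fun e x y h =>
    (hgeq (g x) y (((g x).2.1.mem_iff_of_isLink h).1 (hg x (hFG.vertexSet_mono h.left_mem)))).symm
  have hprF : ∀ e ∈ E(F), F.IsLink e (p e) (r e) := fun e he =>
    (hFG.isLink_iff he).2 (hpr e (hFG.edgeSet_mono he))
  -- vertices which are incident with an edge outside of the frame
  have hdeg2 : ∀ e ∈ M, ∀ v, G.Inc e v → ((g v).1.incidenceSet v).ncard = 2 := by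
    intro e he v hv
    have hvG := hv.vertex_mem
    refine (((hc (g v)).degree v (hg v hvG)).imp_left And.left).resolve_right fun h3 => ?_
    have hsub : (g v).1.incidenceSet v ⊂ G.incidenceSet v := by
      -- With three frame edges at `v`, the edge `e` would be a fourth edge there.
      refine Set.ssubset_iff_of_subset (fun f hf => hf.mono (hQle _)) |>.2 ⟨e, hv, fun h => ?_⟩
      exact ((hmemM e).1 he).2 ((h.mono (g v).2.1.le).edge_mem)
    have := Set.ncard_lt_ncard hsub (hG.finite_incidenceSet v)
    rw [hG.ncard_incidenceSet hvG] at this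
    omega
  have hcycle : ∀ e ∈ M, ∀ v, G.Inc e v → (g v).1.IsCycle → κ v = 0 := by
    intro e he v hv hC
    obtain ⟨f, hf⟩ : ((g v).1.incidenceSet v).Nonempty :=
      Set.nonempty_of_ncard_ne_zero (by rw [hdeg2 e he v hv]; decide)
    rw [← hκ v hv.vertex_mem (hdeg2 e he v hv) f ((hinc v hv.vertex_mem f).1 hf), hc0 _ hC]
  -- the labelling
  have ha : ∀ X : Q, ∃ k : Fin 3, (X.1.IsCycle → k = 0) ∧
      (¬ X.1.IsCycle → ∀ e ∈ D, ∀ y ∈ V(X.1), G.Inc e y → κ y = k) := by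
    intro X
    by_cases hX : X.1.IsCycle
    · exact ⟨0, fun _ => rfl, fun h => absurd hX h⟩
    -- All edges of `D` meeting `X` do so at `x`, so the color at `x` serves as the special color of
    -- `X`.
    · obtain ⟨x, hx⟩ := hD X.1 X.2 hX
      exact ⟨κ x, fun h => absurd h hX, fun _ e he y hy h => by rw [hx e he y hy h]⟩
  choose a ha0 haD using ha
  have hkD : ∀ e ∈ M, e ∈ D → ∀ v, G.Inc e v → κ v = a (g v) := by
    intro e he heD v hv
    by_cases hX : (g v).1.IsCycle
    · rw [ha0 _ hX, hcycle e he v hv hX]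
    · exact haD _ hX e heD v (hg v hv.vertex_mem) hv
  have hMsub : ↑M ⊆ E(G) := fun e he => ((hmemM e).1 he).1
  have hEsub : ↑E ⊆ E(G) := fun e he => hFG.edgeSet_mono ((hmemE e).1 he)
  -- Frame edges contract to loops and contribute nothing; each vertex has odd degree three, and a
  -- component has an even number of vertices.
  have hevenM : ∀ q, bd (g ∘ p) (g ∘ r) M q = 0 := by
    intro q
    have h1 : bd (g ∘ p) (g ∘ r) E q = 0 := Finset.sum_eq_zero fun e he => by
      have := hgF e _ _ (hprF e ((hmemE e).1 he))
      simp only [Function.comp_apply, this, bdry_self, Pi.zero_apply]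
    have h2 : bd (g ∘ p) (g ∘ r) EG q = bd (g ∘ p) (g ∘ r) M q := by
      rw [hEGM, bd_union hME, h1, add_zero]
    have hEGsub : ↑EG ⊆ E(G) := fun e he => (hmemEG e).1 he
    rw [← h2, ← sum_fiber_bd g (hendsW EG hEGsub)]
    have h3 : ∀ v ∈ W.filter (fun v => g v = q), bd p r EG v = 1 := by
      intro v hv
      have hvG := (hmemW v).1 (Finset.mem_filter.1 hv).1
      rw [bd_eq_ncard hG.loopless hpr hEGsub]
      have : {e | e ∈ EG ∧ G.Inc e v} = G.incidenceSet v :=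
        Set.ext fun e => ⟨fun h => h.2, fun h => ⟨(hmemEG e).2 h.edge_mem, h⟩⟩
      rw [this, hG.ncard_incidenceSet hvG]
      rfl
    rw [Finset.sum_congr rfl h3, Finset.sum_const, nsmul_eq_mul, mul_one,
      ZMod.natCast_eq_zero_iff_even, ← Set.ncard_coe_finset]
    have : (↑(W.filter (fun v => g v = q)) : Set α) = V(q.1) := by
      ext v
      rw [Finset.mem_coe, Finset.mem_filter, hmemW]
      exact ⟨fun h => h.2 ▸ hg v h.1, fun h => ⟨(hQle q).vertexSet_mono h, hgeq q v h⟩⟩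
    rw [this]
    exact hF.even q.1 q.2
  set R' : Finset Q := Finset.univ.filter (fun X : Q => X.1 ∈ R) with hR'
  have hmemR : ∀ X : Q, X ∈ R' ↔ X.1 ∈ R := by simp [hR']
  have hout : ∀ e ∈ M, (g (p e) ∉ R' → κ (p e) = a (g (p e))) ∧
      (g (r e) ∉ R' → κ (r e) = a (g (r e))) := by
    intro e he
    have h := hpr e (hMsub he)
    have key : ∀ v, G.Inc e v → g v ∉ R' → κ v = a (g v) := by
      intro v hv hnot
      have hX := hR (g v).1 (g v).2 (fun h' => hnot ((hmemR _).2 h'))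
      rw [ha0 _ hX, hcycle e he v hv hX]
    exact ⟨key _ h.inc_left, key _ h.inc_right⟩
  have hconn' : ∀ X ∈ R', ∀ Y ∈ R', Relation.EqvGen (fun X Y => ∃ e ∈ M, g (p e) = X ∧
      g (r e) = Y ∧ X ∈ R' ∧ Y ∈ R' ∧ κ (p e) = a X ∧ κ (r e) = a Y) X Y := by
    -- A total retraction onto `Q`: the intermediate graphs in a chain of `EqvGen` are not known to
    -- be components.
    let f : Graph α β → Q := fun L => if hL : L.IsComponent F then ⟨L, hL⟩ else g v₀
    have hf : ∀ L : Q, f L.1 = L := fun L => dif_pos L.2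
    intro X hX Y hY
    rw [← hf X, ← hf Y]
    have h := hconn X.1 ((hmemR X).1 hX) Y.1 ((hmemR Y).1 hY) X.2 Y.2
    revert h
    generalize X.1 = A
    generalize Y.1 = B
    intro h
    induction h with
    | refl A => exact Relation.EqvGen.refl _
    | symm A B _ ih => exact ih.symm _ _
    | trans A B C _ _ ih1 ih2 => exact ih1.trans _ _ _ ih2
    | rel A B h =>
      obtain ⟨hA, hB, e, heD, hAc, hBc, hne, x, hx, y, hy, he⟩ := h
      have hgx : g x = f A := by rw [hgeq ⟨A, hAc⟩ x hx]; exact (hf ⟨A, hAc⟩).symm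
      have hgy : g y = f B := by rw [hgeq ⟨B, hBc⟩ y hy]; exact (hf ⟨B, hBc⟩).symm
      have hA' : f A ∈ R' := by rw [hmemR]; simpa [f, hAc] using hA
      have hB' : f B ∈ R' := by rw [hmemR]; simpa [f, hBc] using hB
      have heM : e ∈ M := (hmemM e).2 ⟨he.edge_mem, fun heF => hne <| by
        have := hgF e x y ((hFG.isLink_iff heF).2 he)
        rw [hgeq ⟨A, hAc⟩ x hx, hgeq ⟨B, hBc⟩ y hy] at this
        exact congrArg Subtype.val this⟩
      have h1 := hkD e heM heD x he.inc_left
      have h2 := hkD e heM heD y he.inc_right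
      rw [hgx] at h1
      rw [hgy] at h2
      rcases he.eq_and_eq_or_eq_and_eq (hpr e he.edge_mem) with ⟨rfl, rfl⟩ | ⟨rfl, rfl⟩
      · exact Relation.EqvGen.rel _ _ ⟨e, heM, hgx, hgy, hA', hB', h1, h2⟩
      · exact (Relation.EqvGen.rel _ _ ⟨e, heM, hgy, hgx, hB', hA', h2, h1⟩).symm _ _
  obtain ⟨π, l, hl, hlb⟩ := exists_labelling M (g ∘ p) (g ∘ r) (κ ∘ p) (κ ∘ r) R' a hout hconn'
    hevenM
  -- the coloring of the frame
  set cF : β → Fin 3 := fun e => π (g (p e)) (c (g (p e)) e) with hcF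
  have hcF' : ∀ e v, F.Inc e v → cF e = π (g v) (c (g v) e) := by
    rintro e v hv
    have h := hprF e hv.edge_mem
    rcases hv.eq_or_eq_of_isLink h with rfl | rfl
    · rfl
    · simp only [hcF, hgF e _ _ h]
  refine hG.hasCycleDoubleCover_of_join hpr M E hME ?_ l cF ?_ ?_
  · rw [← Finset.coe_union, ← hEGM]
    exact Set.ext hmemEG
  · intro i v
    have hsub : ↑(E.filter (fun e => cF e ≠ i)) ⊆ E(G) := fun e he =>
      hEsub (Finset.mem_filter.1 he).1
    rw [← even_ncard_iff_bd hG.loopless hpr hsub]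
    by_cases hv : v ∈ V(G)
    · have := ((hc (g v)).perm (π (g v))).even v (hg v hv) i
      convert this using 3
      ext e
      rw [Finset.mem_filter, hmemE, hinc v hv]
      constructor
      · rintro ⟨⟨h1, h2⟩, h3⟩
        have h4 := (hFG.inc_congr h1).2 h3
        exact ⟨h4, by rwa [← hcF' e v h4]⟩
      · rintro ⟨h1, h2⟩
        exact ⟨⟨h1.edge_mem, by rwa [hcF' e v h1]⟩, h1.mono hFG⟩
    · have : {e | e ∈ E.filter (fun e => cF e ≠ i) ∧ G.Inc e v} = ∅ :=
        Set.eq_empty_of_forall_notMem fun e he => hv he.2.vertex_mem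
      rw [this, Set.ncard_empty]
      exact Even.zero
  · intro i
    set N := M.filter (fun e => l e = i) with hN
    have hNsub : ↑N ⊆ E(G) := fun e he => hMsub (Finset.mem_filter.1 he).1
    have hsupp : ∀ v, bd p r N v ≠ 0 → ∃ e ∈ N, G.Inc e v := by
      intro v hv
      rw [bd_eq_ncard hG.loopless hpr hNsub] at hv
      by_contra! h
      have : {e | e ∈ N ∧ G.Inc e v} = ∅ :=
        Set.eq_empty_of_forall_notMem fun e he => h e he.1 he.2
      rw [this] at hv
      simp at hv
    -- An edge labelled `i` avoids the colors of its ends, so these ends lie on frame edges that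
    -- remain after removing color `i`.
    have hex : ∀ v, bd p r N v ≠ 0 → ∃ e, (g v).1.Inc e v ∧ π (g v) (c (g v) e) ≠ i := by
      intro v hv
      obtain ⟨e, heN, hev⟩ := hsupp v hv
      obtain ⟨heM, hle⟩ := Finset.mem_filter.1 heN
      obtain ⟨f, hf⟩ : ((g v).1.incidenceSet v).Nonempty :=
        Set.nonempty_of_ncard_ne_zero (by rw [hdeg2 e heM v hev]; decide)
      refine ⟨f, hf, ?_⟩
      rw [hκ v hev.vertex_mem (hdeg2 e heM v hev) f ((hinc v hev.vertex_mem f).1 hf), ← hle]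
      rcases hev.eq_or_eq_of_isLink (hpr e (hMsub heM)) with rfl | rfl
      · exact (hl e heM).1.symm
      · exact (hl e heM).2.symm
    refine mem_of_sum_fiber_eq_zero g W _ (fun v hv => ?_) (fun x y hx hy hxy => ?_) (fun q => ?_)
    · obtain ⟨e, -, hev⟩ := hsupp v hv
      exact (hmemW v).2 hev.vertex_mem
    · have h1 := hex x hx
      have h2 := hex y hy
      rw [← hxy] at h2
      have hpath := ((hc (g x)).perm (π (g x))).conn i x y h1 h2
      refine bdry_mem_of_eqvGen ?_ (Relation.EqvGen.reflTransGen_le_eqvGen _ _ _ hpath)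
      rintro u w ⟨e, hei, he⟩
      have heF := he.mono (g x).2.1.le
      have hge : g u = g x := hgeq _ u he.left_mem
      have hmem : e ∈ E.filter (fun e => cF e ≠ i) := by
        refine Finset.mem_filter.2 ⟨(hmemE e).2 heF.edge_mem, ?_⟩
        rw [hcF' e u heF.inc_left, hge]
        exact hei
      rcases (heF.mono hFG).eq_and_eq_or_eq_and_eq (hpr e (hEsub (Finset.mem_filter.1 hmem).1)) with
        ⟨rfl, rfl⟩ | ⟨rfl, rfl⟩
      · exact bdry_mem_bdSpan hmem
      · rw [bdry_comm]
        exact bdry_mem_bdSpan hmem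
    · rw [sum_fiber_bd g (hendsW N hNsub)]
      exact hlb i q

/-- A walk of `G` from `X` to `Y` has to leave `X` at some edge. -/
lemma exists_adj_contractFrame (hG : G.Preconnected) (hF : F ≤s G) {X Y : Graph α β}
    (hX : X.IsComponent F) (hY : Y.IsComponent F) (hXY : X ≠ Y) :
    ∃ Z, (G.contractFrame F).Adj X Z := by
  obtain ⟨x, hx⟩ := hX.2.1
  obtain ⟨y, hy⟩ := hY.2.1
  have hVG : ∀ {L : Graph α β}, L.IsComponent F → V(L) ⊆ V(G) := fun hL =>
    (hL.1.le.trans hF.le).vertexSet_mono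
  have hpath := hG x (hVG hX hx) y (hVG hY hy)
  have hyX : y ∉ V(X) := fun h => hXY (hX.eq_of_mem hY h hy)
  clear hy
  induction hpath with
  | refl => exact absurd hx hyX
  | @tail b c _ hbc ih =>
    by_cases hb : b ∈ V(X)
    · obtain ⟨e, he⟩ := hbc
      have hc : (F.compAt c).IsComponent F := compAt_isComponent (hF.vertexSet_eq ▸ he.right_mem)
      exact ⟨F.compAt c, e, hX, hc, fun h => hyX (h ▸ mem_compAt F c), b, hb, c, mem_compAt F c, he⟩
    · exact ih hb

/-- The case of a connected set `D` of cycles such that each other component is a cycle or has a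
neighbor in `D`. -/
theorem IsCubic.hasCycleDoubleCover_of_cVertices (hG : G.IsCubic) (hne : V(G).Nonempty)
    (hF : F.IsKotzigFrame G) {D : Set (Graph α β)} (hD : D ⊆ F.cVertices)
    (hconn : ((G.contractFrame F).induce D).Preconnected)
    (hadj : ∀ X ∈ F.kVertices, ∃ Y ∈ D, (G.contractFrame F).Adj X Y) :
    G.HasCycleDoubleCover 6 := by
  have hadj' : ∀ X, ∃ e : β, X ∈ F.kVertices → ∃ Y ∈ D, (G.contractFrame F).IsLink e X Y := by
    intro X
    by_cases hX : X ∈ F.kVertices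
    · obtain ⟨Y, hY, e, he⟩ := hadj X hX
      exact ⟨e, fun _ => ⟨Y, hY, he⟩⟩
    · obtain ⟨v, hv⟩ := hne
      obtain ⟨e, -⟩ : (G.incidenceSet v).Nonempty :=
        Set.nonempty_of_ncard_ne_zero (by rw [hG.ncard_incidenceSet hv]; decide)
      exact ⟨e, fun h => absurd h hX⟩
  choose φ hφ using hadj'
  -- Only one edge `φ X` is kept for each component `X` that is not a cycle. It leads into `D`, so
  -- `X` becomes a leaf and is met in a single vertex.
  set D' : Set β := {e | ∃ X ∈ D, ∃ Y ∈ D, (G.contractFrame F).IsLink e X Y} ∪ φ '' F.kVertices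
    with hD'
  refine hG.hasCycleDoubleCover_of_frame hne hF (D ∪ F.kVertices) D' (fun L hL hLR => ?_)
    (fun X hX Y hY _ _ => ?_) (fun X hX hXC => ?_)
  · by_contra hC
    exact hLR (Or.inr ⟨hL, hC⟩)
  · set s : Graph α β → Graph α β → Prop := fun X Y => X ∈ D ∪ F.kVertices ∧
      Y ∈ D ∪ F.kVertices ∧ ∃ e ∈ D', (G.contractFrame F).IsLink e X Y with hs
    have hDD : ∀ X ∈ D, ∀ Y ∈ D, Relation.EqvGen s X Y := by
      intro X hX Y hY
      refine Relation.EqvGen.mono ?_ _ _ (Relation.EqvGen.reflTransGen_le_eqvGen _ _ _ (hconn X hX Y hY))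
      rintro A B ⟨e, he, hA, hB⟩
      exact ⟨Or.inl hA, Or.inl hB, e, Or.inl ⟨A, hA, B, hB, he⟩, he⟩
    have hDK : ∀ X ∈ D ∪ F.kVertices, ∃ Y ∈ D, Relation.EqvGen s X Y := by
      rintro X (hX | hX)
      · exact ⟨X, hX, Relation.EqvGen.refl _⟩
      · obtain ⟨Y, hY, he⟩ := hφ X hX
        exact ⟨Y, hY, Relation.EqvGen.rel _ _
          ⟨Or.inr hX, Or.inl hY, φ X, Or.inr ⟨X, hX, rfl⟩, he⟩⟩
    obtain ⟨A, hA, hXA⟩ := hDK X hX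
    obtain ⟨B, hB, hYB⟩ := hDK Y hY
    exact (hXA.trans _ _ _ (hDD A hA B hB)).trans _ _ _ (hYB.symm _ _)
  · have hnotD : ∀ Y ∈ D, ∀ y ∈ V(Y), y ∉ V(X) := fun Y hY y hy hyX =>
      hXC (hX.eq_of_mem (hD hY).1 hyX hy ▸ (hD hY).2)
    obtain ⟨Y, hY, -, -, -, x, hx, y, hy, he⟩ := hφ X ⟨hX, hXC⟩
    refine ⟨x, ?_⟩
    rintro e (⟨A, hA, B, hB, -, -, -, a, ha, b, hb, hab⟩ | ⟨Z, hZ, rfl⟩) z hz hez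
    · rcases hez.eq_or_eq_of_isLink hab with rfl | rfl
      · exact absurd hz (hnotD A hA _ ha)
      · exact absurd hz (hnotD B hB _ hb)
    · obtain ⟨B, hB, -, -, -, a, ha, b, hb, hab⟩ := hφ Z hZ
      rcases hez.eq_or_eq_of_isLink hab with rfl | rfl
      · obtain rfl := hX.eq_of_mem hZ.1 hz ha
        rcases hez.eq_or_eq_of_isLink he with h | rfl
        · exact h
        · exact absurd hz (hnotD Y hY _ hy)
      · exact absurd hz (hnotD B hB _ hb)

end Main

end Graph

/-! ### Reduction of the three hypotheses to connected sets of components -/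

theorem corollary1 {α β : Type*} (G F : Graph α β) (hcubic : G.IsCubic)
    (hconn : G.IsTwoConnected) (hF : F.IsKotzigFrame G)
    (h :
      ((∀ X ∈ F.kVertices, ∀ Y ∈ F.kVertices, ¬ (G.contractFrame F).Adj X Y) ∧
        ((G.contractFrame F).deleteVerts F.kVertices).Preconnected) ∨
      ((∀ X ∈ F.kVertices, ∃ Y ∈ F.cVertices, (G.contractFrame F).Adj X Y) ∧
        ((G.contractFrame F).deleteVerts F.kVertices).Preconnected) ∨
      (∃ D ⊆ F.cVertices, ((G.contractFrame F).induce D).Preconnected ∧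
        ∀ X ∈ F.kVertices, ∃ Y ∈ D, (G.contractFrame F).Adj X Y)) :
    G.HasCycleDoubleCover 6 := by
  have hne : V(G).Nonempty := hconn.2.1.1
  have hdel : (G.contractFrame F).deleteVerts F.kVertices =
      (G.contractFrame F).induce F.cVertices := by
    have : V(G.contractFrame F) \ F.kVertices = F.cVertices := by
      ext L
      change (L.IsComponent F ∧ ¬ (L.IsComponent F ∧ ¬ L.IsCycle)) ↔ L.IsComponent F ∧ L.IsCycle
      tauto
    rw [Graph.deleteVerts, this]
  rw [hdel] at h
  rcases h with ⟨hind, hc⟩ | ⟨hadj, hc⟩ | ⟨D, hD, hc, hadj⟩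
  · by_cases hsub : ∀ X Y : Graph α β, X.IsComponent F → Y.IsComponent F → X = Y
    -- With a single component no connecting edges are needed. This case is separate because that
    -- component may fail to be a cycle and has no neighbor.
    · refine hcubic.hasCycleDoubleCover_of_frame hne hF Set.univ ∅
        (fun L _ h => absurd (Set.mem_univ L) h) (fun X _ Y _ hX hY => ?_)
        (fun X _ _ => ⟨hne.some, fun e he => absurd he (Set.notMem_empty e)⟩)
      rw [hsub X Y hX hY]
      exact Relation.EqvGen.refl _
    -- With several components, (i) implies (ii): `X` has a neighbor because `G` is connected, and
    -- by independence this neighbor is a cycle.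
    · refine hcubic.hasCycleDoubleCover_of_cVertices hne hF subset_rfl hc fun X hX => ?_
      obtain ⟨Y, hY, hXY⟩ : ∃ Y : Graph α β, Y.IsComponent F ∧ X ≠ Y := by
        by_contra! h
        exact hsub fun Y Z hY hZ => (h Y hY).symm.trans (h Z hZ)
      obtain ⟨Z, hZ⟩ := Graph.exists_adj_contractFrame hconn.2.1.2 hF.spanning hX.1 hY hXY
      have hZF : Z.IsComponent F := hZ.right_mem
      refine ⟨Z, ⟨hZF, ?_⟩, hZ⟩
      by_contra hZC
      exact hind X hX Z ⟨hZF, hZC⟩ hZ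
  · exact hcubic.hasCycleDoubleCover_of_cVertices hne hF subset_rfl hc hadj
  · exact hcubic.hasCycleDoubleCover_of_cVertices hne hF hD hc hadj
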